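/- **Setting.** Let $\mathcal H$ be the real vector space of Hermitian $2\times2$ complex matrices, $\mathcal H_0^+=\{S\in\mathcal H:\det S=0,\ \operatorname{tr}S>0\}$, and let $\mathbb R^{1,3}$ be Minkowski space with coordinates $(T,X,Y,Z)$, inner product $\langle p,p'\rangle=TT'-XX'-YY'-ZZ'$, positive light cone $L^+=\{\langle p,p\rangle=0,\ T>0\}$ and hyperboloid $\mathbb H=\{\langle x,x\rangle=1,\ T>0\}$. A flag in $\mathbb R^{1,3}$ (resp. $\mathcal H$) is a triple $(p,V,o)$ with $p\in L^+$ (resp. $\mathcal H_0^+$), $V$ a $2$-plane spanned by $p$ and a tangent vector $v$ to the cone at $p$, and $o$ an orientation of $V/\mathbb Rp$; it is written $[[p,v]]$ when $o$ is the class of $v$. A horosphere in $\mathbb H$ is a nonempty intersection of $\mathbb H$ with an affine $3$-plane $\Pi=\{\langle x,n\rangle=c\}$, $n\ne0$ lightlike; its centre is the unique ray of $L^+$ that does not meet $\Pi$. Define * $\mathbf F(\kappa)=[[\mathbf f(\kappa),D_\kappa\mathbf f(\mathcal Z(\kappa))]]$ for $0\neq\kappa\in\mathbb C^2$, where $\mathbf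 f(\kappa)=\kappa\kappa^*$ and $\mathcal Z(\alpha,\beta)=(i\overline\beta,-i\overline\alpha)$; * $\mathbf G(S,V,o)=(\mathbf g(S),\mathbf g(V),\mathbf g(o))$, where $\mathbf g\begin{pmatrix}a&b+ci\\b-ci&d\end{pmatrix}=(a+d,2b,2c,a-d)$; * $\mathbf H(p,V,o)=(\mathbf h(p),\,V\cap T\mathbf h(p))$, where $\mathbf h(p)=\{x\in\mathbb H:\langle x,p\rangle=1\}$ and each line $V\cap T_q\mathbf h(p)$ is oriented by $o$; * $\mathbf I$, $\mathbf J$: transport by the isometries $\mathfrak i$, $\mathfrak j$ and their derivatives, where $\mathfrak i(T,X,Y,Z)=\frac1{1+T}(X,Y,Z)$ maps $\mathbb H$ to the unit ball $\mathbb D$, and $\mathfrak j$ maps $\mathbb D$ to the upper half space $\mathbb U=\{(x,y,z):z>0\}$ and extends stereographic projection $(x,y,z)\mapsto\frac{x+iy}{1-z}$ on the spheres at infinity $S^2\to\mathbb C\cup\{\infty\}$, i.e. $\mathfrak j(x,y,z)=\frac{(2x,\,2y,\,1-x^2-y^2-z^2)}{x^2+y^2+(1-z)^2}$. Horospheres in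 $\mathbb U$ are the images of horospheres in $\mathbb H$ under $\mathfrak j\circ\mathfrak i$; their centres are the images in $\mathbb C\cup\{\infty\}$ of the centres in $\mathbb H$ under the extension of $\mathfrak j\circ\mathfrak i$ to infinity, which sends the ray of $(T,X,Y,Z)\in L^+$ to $\frac{X+iY}{T-Z}$. A decorated horosphere is a horosphere with an oriented tangent line field which is parallel, i.e. invariant under those isometries given by parabolic elements (trace $\pm2$) of $SL(2,\mathbb C)$ which preserve the horosphere; here $A\in SL(2,\mathbb C)$ acts on $\mathbb H$ via $S\mapsto ASA^*$ on $\mathcal H\cong\mathbb R^{1,3}$, and on $\mathbb U$ via $\mathfrak j\circ\mathfrak i$. A complex number $a+bi$ specifies a decoration at a point where the tangent plane is horizontal if the vector $(a,b,0)$ directs the oriented line there. Put $\mathbf K=\mathbf J\circ\mathbf I\circ\mathbf H\circ\mathbf G\circ\mathbf F$ and $\mathbf k(\kappa)=\mathfrak j(\mathfrak i(\mathbf h(\mathbf g(\mathbf f(\kappa)))))$. **Theorem.** Let $(\xi,\eta)\in\mathbb C^2\setminus\{(0,0)\}$. Then $\mathbf K(\xi,\eta)$ is a decorated horosphere in $\mathbb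 U$, centred at $\xi/\eta\in\mathbb C\cup\{\infty\}$ (with $\xi/0=\infty$), and: 1. if $\eta\ne0$, its horosphere is the Euclidean sphere of diameter $|\eta|^{-2}$ tangent to $\mathbb C=\{z=0\}$ at $\xi/\eta$ (without the point of tangency), and its decoration is specified at the north pole (highest point) by $i\eta^{-2}$; 2. if $\eta=0$, its horosphere is the horizontal plane at height $|\xi|^2$, and its decoration is specified at every point by $i\xi^2$. The underlying horosphere of $\mathbf K(\xi,\eta)$ is $\mathbf k(\xi,\eta)$. -/

import Mathlib

open Matrix Topology

attribute [local instance] Matrix.normedAddCommGroup Matrix.normedSpace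

noncomputable section

namespace SpinorHorosphere

/-! ### Tangent vectors, oriented null flags, oriented line fields -/

/-- The tangent vectors at `x` of a subset `M` of a normed space: velocities at `x` of curves that
run in `M`. For the submanifolds used below this is the usual tangent space. -/
def tangentVectors {E : Type*} [NormedAddCommGroup E] [NormedSpace ℝ E] (M : Set E) (x : E) :
    Set E :=
  {v | ∃ γ : ℝ → E, γ 0 = x ∧ (∀ᶠ t in 𝓝 (0 : ℝ), γ t ∈ M) ∧ HasDerivAt γ v 0}

/-- The open half-plane `ℝ p + ℝ⁺ v`. -/
def openHalfPlane {E : Type*} [NormedAddCommGroup E] [NormedSpace ℝ E] (p v : E) : Set E :=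
  {w | ∃ a b : ℝ, 0 < b ∧ w = a • p + b • v}

/-- A pointed oriented flag `(p, V, o)` based on a cone `C` (the positive light cone, or the
corresponding cone of Hermitian matrices): `p ∈ C`, `V` is a 2-plane spanned by `p` and a tangent
vector to `C` at `p`, and `o` is an orientation of the line `V / ℝ p`. The orientation is recorded
as the set `pos` of all vectors of `V` whose class in `V / ℝ p` is a positive basis. -/
@[ext]
structure Flag {E : Type*} [NormedAddCommGroup E] [NormedSpace ℝ E] (C : Set E) where
  point : E
  plane : Submodule ℝ E
  pos : Set E
  point_mem : point ∈ C
  exists_rep : ∃ v ∈ tangentVectors C point, LinearIndependent ℝ ![point, v] ∧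
    plane = Submodule.span ℝ {point, v} ∧ pos = openHalfPlane point v

/-- The flag `[[p, v]]`. -/
def Flag.mk' {E : Type*} [NormedAddCommGroup E] [NormedSpace ℝ E] {C : Set E} (p v : E)
    (hp : p ∈ C) (hv : v ∈ tangentVectors C p) (h : LinearIndependent ℝ ![p, v]) : Flag C where
  point := p
  plane := Submodule.span ℝ {p, v}
  pos := openHalfPlane p v
  point_mem := hp
  exists_rep := ⟨v, hv, h, rfl, rfl⟩

/-- A subset `carrier` of a normed space, with a set `dir q` of vectors attached to each point `q`.
An oriented line at `q` is given by the open ray `dir q` of the vectors which direct it. -/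
@[ext]
structure DirectedSet (E : Type*) where
  carrier : Set E
  dir : E → Set E

/-- `dir` is a field of oriented tangent lines along `carrier` (and is empty elsewhere). -/
def DirectedSet.IsOrientedLineField {E : Type*} [NormedAddCommGroup E] [NormedSpace ℝ E]
    (X : DirectedSet E) : Prop :=
  (∀ q ∈ X.carrier, ∃ v ∈ tangentVectors X.carrier q, v ≠ 0 ∧
    X.dir q = {w | ∃ c : ℝ, 0 < c ∧ w = c • v}) ∧
  ∀ q ∉ X.carrier, X.dir q = ∅

/-- Transport by a map and its derivative. -/
def DirectedSet.push {E E' : Type*} [NormedAddCommGroup E] [NormedSpace ℝ E]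
    [NormedAddCommGroup E'] [NormedSpace ℝ E'] (φ : E → E') (X : DirectedSet E) :
    DirectedSet E' where
  carrier := φ '' X.carrier
  dir y := {w | ∃ q ∈ X.carrier, φ q = y ∧ ∃ v ∈ X.dir q, w = fderiv ℝ φ q v}

/-! ### Hermitian matrices -/

/-- The real vector space of Hermitian 2 × 2 complex matrices. -/
abbrev Herm : Type := selfAdjoint.submodule ℝ (Matrix (Fin 2) (Fin 2) ℂ)

/-- Singular Hermitian matrices with positive trace. -/
def hermCone : Set Herm := {S | (S : Matrix (Fin 2) (Fin 2) ℂ).det = 0 ∧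
  0 < (S : Matrix (Fin 2) (Fin 2) ℂ).trace.re}

/-- `f κ = κ κ*`. -/
def f (κ : Fin 2 → ℂ) : Herm :=
  ⟨vecMulVec κ (star κ), by
    change star _ = _
    rw [star_eq_conjTranspose, conjTranspose_vecMulVec, star_star]⟩

/-- `Z (α, β) = (i β̄, - i ᾱ)`. -/
def Z (κ : Fin 2 → ℂ) : Fin 2 → ℂ := ![Complex.I * star (κ 1), -Complex.I * star (κ 0)]

/-- `A · S = A S A*`. -/
def hermAct (A : SpecialLinearGroup (Fin 2) ℂ) (S : Herm) : Herm :=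
  ⟨A.1 * S.1 * A.1ᴴ, by
    have h : S.1ᴴ = S.1 := S.2
    change (_)ᴴ = _
    rw [conjTranspose_mul, conjTranspose_mul, h, conjTranspose_conjTranspose, Matrix.mul_assoc]⟩

/-! ### Minkowski space -/

/-- Minkowski space, with coordinates `(T, X, Y, Z)`. -/
abbrev Mink : Type := Fin 4 → ℝ

/-- The Minkowski inner product. -/
def mink (p q : Mink) : ℝ := p 0 * q 0 - p 1 * q 1 - p 2 * q 2 - p 3 * q 3

/-- The positive light cone. -/
def lightCone : Set Mink := {p | mink p p = 0 ∧ 0 < p 0}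

/-- The linear isomorphism from Hermitian matrices to Minkowski space,
`(a, b + c i; b - c i, d) ↦ (a + d, 2 b, 2 c, a - d)`. -/
def g : Herm ≃ₗ[ℝ] Mink where
  toFun S := ![(S.1 0 0).re + (S.1 1 1).re, 2 * (S.1 0 1).re, 2 * (S.1 0 1).im,
    (S.1 0 0).re - (S.1 1 1).re]
  map_add' S S' := by
    ext i; fin_cases i <;> simp <;> ring
  map_smul' c S := by
    ext i; fin_cases i <;> simp <;> ring
  invFun p := ⟨!![(((p 0 + p 3) / 2 : ℝ) : ℂ), ⟨p 1 / 2, p 2 / 2⟩;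
      ⟨p 1 / 2, -(p 2 / 2)⟩, (((p 0 - p 3) / 2 : ℝ) : ℂ)], by
    change (_)ᴴ = _
    ext i j
    fin_cases i <;> fin_cases j <;> simp [conjTranspose_apply, Complex.ext_iff]⟩
  left_inv S := by
    have h : ∀ i j, star (S.1 j i) = S.1 i j := fun i j => congrFun (congrFun S.2 i) j
    have h0 := congrArg Complex.im (h 0 0)
    have h1 := congrArg Complex.im (h 1 1)
    have h2 := h 1 0
    simp only [RCLike.star_def, Complex.conj_im] at h0 h1
    ext i j
    fin_cases i <;> fin_cases j <;> simp [Complex.ext_iff, ← h2] <;> linarith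
  right_inv p := by
    ext i; fin_cases i <;> simp <;> ring

/-- The action of `SL(2, ℂ)` on Minkowski space. -/
def minkAct (A : SpecialLinearGroup (Fin 2) ℂ) (p : Mink) : Mink := g (hermAct A (g.symm p))

/-! ### From spinors to flags -/

theorem f_mem_hermCone {κ : Fin 2 → ℂ} (hκ : κ ≠ 0) : f κ ∈ hermCone := by
  constructor
  · simp [f, det_fin_two, vecMulVec_apply]
    ring
  · have h : 0 < Complex.normSq (κ 0) + Complex.normSq (κ 1) := by
      by_contra! hc
      have h0 := Complex.normSq_nonneg (κ 0)
      have h1 := Complex.normSq_nonneg (κ 1)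
      apply hκ
      have e0 : κ 0 = 0 := Complex.normSq_eq_zero.1 (by linarith)
      have e1 : κ 1 = 0 := Complex.normSq_eq_zero.1 (by linarith)
      ext i
      fin_cases i
      · exact e0
      · exact e1
    simpa [f, trace_fin_two, vecMulVec_apply, Complex.mul_conj] using h

theorem hasDerivAt_f (κ ν : Fin 2 → ℂ) :
    ∃ D : Herm, (D : Matrix (Fin 2) (Fin 2) ℂ) = vecMulVec κ (star ν) + vecMulVec ν (star κ) ∧
      HasDerivAt (fun t : ℝ => f (κ + t • ν)) D 0 := by
  refine ⟨⟨vecMulVec κ (star ν) + vecMulVec ν (star κ), ?_⟩, rfl, ?_⟩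
  · change (_)ᴴ = _
    rw [conjTranspose_add, conjTranspose_vecMulVec, conjTranspose_vecMulVec, star_star, star_star,
      add_comm]
  · set D : Herm := ⟨vecMulVec κ (star ν) + vecMulVec ν (star κ), _⟩ with hD
    have h : (fun t : ℝ => f (κ + t • ν)) = fun t : ℝ => f κ + t • D + (t ^ 2) • f ν := by
      funext t
      apply Subtype.ext
      ext i j
      simp [f, hD, vecMulVec_apply]
      ring
    rw [h]
    have h1 : HasDerivAt (fun t : ℝ => t • D) D 0 := by
      have := (hasDerivAt_id (0 : ℝ)).smul_const D
      rw [one_smul] at this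
      exact this
    have h2 : HasDerivAt (fun t : ℝ => t ^ 2 • f ν) 0 0 := by
      have := (hasDerivAt_pow 2 (0 : ℝ)).smul_const (f ν)
      simp only [Nat.cast_ofNat, Nat.add_one_sub_one, pow_one, mul_zero, zero_smul] at this
      exact this
    have h3 := (h1.const_add (f κ)).add h2
    rw [add_zero] at h3
    exact h3

theorem lineDeriv_f (κ ν : Fin 2 → ℂ) :
    ((lineDeriv ℝ f κ ν : Herm) : Matrix (Fin 2) (Fin 2) ℂ) =
      vecMulVec κ (star ν) + vecMulVec ν (star κ) := by
  obtain ⟨D, h, hD⟩ := hasDerivAt_f κ ν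
  rw [← h, lineDeriv, hD.deriv]

theorem lineDeriv_f_mem {κ : Fin 2 → ℂ} (hκ : κ ≠ 0) (ν : Fin 2 → ℂ) :
    lineDeriv ℝ f κ ν ∈ tangentVectors hermCone (f κ) := by
  obtain ⟨D, -, hD⟩ := hasDerivAt_f κ ν
  refine ⟨fun t => f (κ + t • ν), by simp, ?_, ?_⟩
  · have hc : Filter.Tendsto (fun t : ℝ => κ + t • ν) (𝓝 0) (𝓝 κ) := by
      have : Continuous fun t : ℝ => κ + t • ν := by fun_prop
      simpa using this.tendsto 0
    filter_upwards [hc.eventually_ne hκ] with t ht using f_mem_hermCone ht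
  · rw [lineDeriv, hD.deriv]
    exact hD

theorem linearIndependent_f {κ : Fin 2 → ℂ} (hκ : κ ≠ 0) :
    LinearIndependent ℝ ![f κ, lineDeriv ℝ f κ (Z κ)] := by
  rw [LinearIndependent.pair_iff]
  intro s t h
  have hN := (f_mem_hermCone hκ).2
  have h' := congrArg (fun S : Herm => (S : Matrix (Fin 2) (Fin 2) ℂ)) h
  simp only [Submodule.coe_add, Submodule.coe_smul, lineDeriv_f, Submodule.coe_zero] at h'
  have e := fun k l => congrFun (congrFun h' k) l
  simp only [f, Matrix.add_apply, Matrix.smul_apply, vecMulVec_apply, Pi.star_apply,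
    Matrix.zero_apply, Complex.real_smul] at e
  have z0 : Z κ 0 = Complex.I * star (κ 1) := rfl
  have z1 : Z κ 1 = -Complex.I * star (κ 0) := rfl
  have e00 := e 0 0
  have e01 := e 0 1
  have e10 := e 1 0
  have e11 := e 1 1
  simp only [z0, z1, star_mul', star_neg, star_star] at e00 e01 e10 e11
  have hI : star Complex.I = -Complex.I := by simp
  rw [hI] at e00 e01 e10 e11
  have hI2 : Complex.I * Complex.I = -1 := Complex.I_mul_I
  have hn : κ 0 * star (κ 0) + κ 1 * star (κ 1) ≠ 0 := by
    intro h0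
    simp only [f, trace_fin_two, vecMulVec_apply, Pi.star_apply] at hN
    rw [h0] at hN
    simp at hN
  have ht : (t : ℂ) * (κ 0 * star (κ 0) + κ 1 * star (κ 1)) ^ 2 = 0 := by
    linear_combination (-Complex.I * κ 1) * (κ 0 * e00 + κ 1 * e01) +
      Complex.I * κ 0 * (κ 0 * e10 + κ 1 * e11) +
      t * (κ 0 * star (κ 0) + κ 1 * star (κ 1)) ^ 2 * hI2
  have ht0 : t = 0 := by
    have := (mul_eq_zero.1 ht).resolve_right (pow_ne_zero 2 hn)
    exact_mod_cast this
  refine ⟨?_, ht0⟩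
  subst ht0
  have hs : (s : ℂ) * (κ 0 * star (κ 0) + κ 1 * star (κ 1)) = 0 := by
    linear_combination e00 + e11
  exact_mod_cast (mul_eq_zero.1 hs).resolve_right hn

/-- The map from nonzero spinors to flags of Hermitian matrices,
`F κ = [[f κ, D_κ f (Z κ)]]`. -/
def F (κ : Fin 2 → ℂ) (hκ : κ ≠ 0) : Flag hermCone :=
  Flag.mk' (f κ) (lineDeriv ℝ f κ (Z κ)) (f_mem_hermCone hκ) (lineDeriv_f_mem hκ _)
    (linearIndependent_f hκ)

theorem g_mem_lightCone {S : Herm} (hS : S ∈ hermCone) : g S ∈ lightCone := by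
  have h : ∀ k l, star (S.1 l k) = S.1 k l := fun k l => congrFun (congrFun S.2 k) l
  have h0 := congrArg Complex.im (h 0 0)
  have h1 := congrArg Complex.im (h 1 1)
  have h2 := h 1 0
  obtain ⟨hd, ht⟩ := hS
  simp only [RCLike.star_def, Complex.conj_im] at h0 h1
  rw [det_fin_two, ← h2] at hd
  have hd' := congrArg Complex.re hd
  simp [trace_fin_two] at hd' ht
  constructor
  · simp [mink, g]
    have e0 : (S.1 0 0).im = 0 := by linarith
    rw [e0] at hd'
    linear_combination 4 * hd'
  · simpa [g] using ht

theorem g_mem_tangentVectors {S U : Herm} (h : U ∈ tangentVectors hermCone S) :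
    g U ∈ tangentVectors lightCone (g S) := by
  obtain ⟨γ, h0, hm, hd⟩ := h
  refine ⟨fun t => g (γ t), congrArg g h0, hm.mono fun t ht => g_mem_lightCone ht, ?_⟩
  have := (g.toContinuousLinearEquiv : Herm →L[ℝ] Mink).hasFDerivAt.comp_hasDerivAt 0 hd
  exact this

/-- The map on flags induced by `g`. -/
def G (Φ : Flag hermCone) : Flag lightCone where
  point := g Φ.point
  plane := Φ.plane.map (g : Herm →ₗ[ℝ] Mink)
  pos := g '' Φ.pos
  point_mem := g_mem_lightCone Φ.point_mem
  exists_rep := by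
    obtain ⟨v, hv, hli, hpl, hpos⟩ := Φ.exists_rep
    refine ⟨g v, g_mem_tangentVectors hv, ?_, ?_, ?_⟩
    · rw [LinearIndependent.pair_iff] at hli ⊢
      intro s t h
      exact hli s t (g.injective (by simpa using h))
    · rw [hpl, Submodule.map_span, Set.image_pair]
      rfl
    · rw [hpos]
      ext w
      constructor
      · rintro ⟨_, ⟨a, b, hb, rfl⟩, rfl⟩
        exact ⟨a, b, hb, by simp⟩
      · rintro ⟨a, b, hb, rfl⟩
        exact ⟨_, ⟨a, b, hb, rfl⟩, by simp⟩

/-! ### The hyperboloid model -/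

/-- The hyperboloid model of hyperbolic 3-space. -/
def hyperboloid : Set Mink := {x | mink x x = 1 ∧ 0 < x 0}

/-- Affine 3-planes with a lightlike normal vector. -/
def IsLightlikePlane (P : Set Mink) : Prop :=
  ∃ n : Mink, n ≠ 0 ∧ mink n n = 0 ∧ ∃ c : ℝ, P = {x | mink x n = c}

/-- Horospheres in the hyperboloid model. -/
def IsHorosphereHyp (s : Set Mink) : Prop :=
  s.Nonempty ∧ ∃ P, IsLightlikePlane P ∧ s = hyperboloid ∩ P

/-- The centre of a horosphere cut out by the lightlike plane `P`: the unique ray of the positive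
light cone, represented here by a point `p` on it, which does not meet `P`. -/
def IsCentreHyp (s : Set Mink) (p : Mink) : Prop :=
  s.Nonempty ∧ p ∈ lightCone ∧ ∃ P, IsLightlikePlane P ∧ s = hyperboloid ∩ P ∧
    ∀ p' ∈ lightCone, (∀ t : ℝ, 0 < t → t • p' ∉ P) ↔ SameRay ℝ p' p

/-- The horosphere of a point of the positive light cone. -/
def h (p : Mink) : Set Mink := {x | x ∈ hyperboloid ∧ mink x p = 1}

/-- The map from flags to horospheres with oriented line fields: at a point `q` of `h p` the line is
`V ∩ T_q (h p)`, oriented by `o`. -/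
def H (Φ : Flag lightCone) : DirectedSet Mink where
  carrier := h Φ.point
  dir q := {w | q ∈ h Φ.point ∧ w ∈ Φ.plane ∧ w ∈ tangentVectors (h Φ.point) q ∧ w ∈ Φ.pos}

/-! ### The disc model and the upper half space model -/

/-- Euclidean 3-space. -/
abbrev E3 : Type := EuclideanSpace ℝ (Fin 3)

/-- The disc model, with the metric `4 |dx|² / (1 - |x|²)²`. -/
def disc : Set E3 := {x | ‖x‖ < 1}

/-- The upper half space model, with the metric `|dx|² / z²`. -/
def upper : Set E3 := {x | 0 < x 2}

/-- The isometry from the hyperboloid to the disc, `(T, X, Y, Z) ↦ (X, Y, Z) / (1 + T)`. -/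
def i (q : Mink) : E3 := !₂[q 1 / (1 + q 0), q 2 / (1 + q 0), q 3 / (1 + q 0)]

/-- The inverse of `i`. -/
def iInv (x : E3) : Mink :=
  ![(1 + ‖x‖ ^ 2) / (1 - ‖x‖ ^ 2), 2 * x 0 / (1 - ‖x‖ ^ 2), 2 * x 1 / (1 - ‖x‖ ^ 2),
    2 * x 2 / (1 - ‖x‖ ^ 2)]

theorem norm_sq_E3 (x : E3) : ‖x‖ ^ 2 = x 0 ^ 2 + x 1 ^ 2 + x 2 ^ 2 := by
  simp [EuclideanSpace.norm_sq_eq, Fin.sum_univ_three]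

theorem i_mem_disc {q : Mink} (hq : q ∈ hyperboloid) : i q ∈ disc := by
  obtain ⟨h1, h0⟩ := hq
  have hn := norm_sq_E3 (i q)
  have hT : (1 + q 0) ≠ 0 := by positivity
  have : ‖i q‖ ^ 2 < 1 := by
    rw [hn]
    simp only [i, mink] at *
    simp
    rw [div_pow, div_pow, div_pow, ← add_div, ← add_div, div_lt_one (by positivity)]
    nlinarith
  exact (sq_lt_one_iff₀ (norm_nonneg _)).1 this

theorem iInv_i {q : Mink} (hq : q ∈ hyperboloid) : iInv (i q) = q := by
  obtain ⟨h1, h0⟩ := hq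
  have hT : (1 + q 0) ≠ 0 := by positivity
  have hn : ‖i q‖ ^ 2 = (q 0 - 1) / (1 + q 0) := by
    rw [norm_sq_E3]
    simp only [i, mink] at *
    simp
    field_simp
    linear_combination -h1
  have hn' : 1 - ‖i q‖ ^ 2 = 2 / (1 + q 0) := by
    rw [hn]; field_simp; ring
  have hn'' : 1 + ‖i q‖ ^ 2 = 2 * q 0 / (1 + q 0) := by
    rw [hn]; field_simp; ring
  ext k
  simp only [iInv, hn', hn'']
  fin_cases k <;> simp [i] <;> field_simp

theorem i_iInv {x : E3} (hx : x ∈ disc) : iInv x ∈ hyperboloid ∧ i (iInv x) = x := by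
  have hlt : ‖x‖ ^ 2 < 1 := (sq_lt_one_iff₀ (norm_nonneg _)).2 hx
  have hp : 0 < 1 - ‖x‖ ^ 2 := by linarith
  have hn := norm_sq_E3 x
  refine ⟨⟨?_, ?_⟩, ?_⟩
  · simp [iInv, mink]
    field_simp
    rw [hn]
    ring
  · simp [iInv]
    positivity
  · have : 1 + (1 + ‖x‖ ^ 2) / (1 - ‖x‖ ^ 2) = 2 / (1 - ‖x‖ ^ 2) := by field_simp; ring
    ext k
    fin_cases k <;> simp [i, iInv, this] <;> field_simp

/-- The extension of `i` to the spheres at infinity, as a map on the positive light cone. -/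
def iBdry (p : Mink) : E3 := !₂[p 1 / p 0, p 2 / p 0, p 3 / p 0]

/-- Stereographic projection from the sphere at infinity of the disc to `ℂ ∪ {∞}`. -/
def jBdry (x : E3) : OnePoint ℂ :=
  if x = !₂[0, 0, 1] then OnePoint.infty
  else (((x 0 : ℂ) + Complex.I * (x 1 : ℂ)) / (1 - (x 2 : ℂ)) : ℂ)

/-- The isometry from the disc to the upper half space which extends `jBdry`: the inversion in the
sphere of radius `√2` about `(0, 0, 1)`, followed by the reflection `z ↦ -z`. -/
def j (x : E3) : E3 :=
  !₂[2 * x 0 / (x 0 ^ 2 + x 1 ^ 2 + (1 - x 2) ^ 2),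
    2 * x 1 / (x 0 ^ 2 + x 1 ^ 2 + (1 - x 2) ^ 2),
    (1 - (x 0 ^ 2 + x 1 ^ 2 + x 2 ^ 2)) / (x 0 ^ 2 + x 1 ^ 2 + (1 - x 2) ^ 2)]

/-- The inverse of `j`. -/
def jInv (y : E3) : E3 :=
  !₂[2 * y 0 / (y 0 ^ 2 + y 1 ^ 2 + (1 + y 2) ^ 2),
    2 * y 1 / (y 0 ^ 2 + y 1 ^ 2 + (1 + y 2) ^ 2),
    (y 0 ^ 2 + y 1 ^ 2 + y 2 ^ 2 - 1) / (y 0 ^ 2 + y 1 ^ 2 + (1 + y 2) ^ 2)]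

theorem disc_pos {x : E3} (hx : x ∈ disc) :
    0 < x 0 ^ 2 + x 1 ^ 2 + (1 - x 2) ^ 2 ∧ x 0 ^ 2 + x 1 ^ 2 + x 2 ^ 2 < 1 := by
  have hlt : ‖x‖ ^ 2 < 1 := (sq_lt_one_iff₀ (norm_nonneg _)).2 hx
  rw [norm_sq_E3] at hlt
  refine ⟨?_, hlt⟩
  nlinarith [sq_nonneg (x 0), sq_nonneg (x 1), sq_nonneg (1 - x 2), sq_nonneg (1 + x 2)]

theorem jInv_j {x : E3} (hx : x ∈ disc) : j x ∈ upper ∧ jInv (j x) = x := by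
  obtain ⟨hd, hlt⟩ := disc_pos hx
  set d := x 0 ^ 2 + x 1 ^ 2 + (1 - x 2) ^ 2 with hdd
  have h0 : j x 0 = 2 * x 0 / d := rfl
  have h1 : j x 1 = 2 * x 1 / d := rfl
  have h2 : j x 2 = (1 - (x 0 ^ 2 + x 1 ^ 2 + x 2 ^ 2)) / d := rfl
  refine ⟨?_, ?_⟩
  · change 0 < j x 2
    rw [h2]
    exact div_pos (by linarith) hd
  · have e : (j x 0) ^ 2 + (j x 1) ^ 2 + (1 + j x 2) ^ 2 = 4 / d := by
      rw [h0, h1, h2]; field_simp; rw [hdd]; ring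
    have e' : (j x 0) ^ 2 + (j x 1) ^ 2 + (j x 2) ^ 2 - 1 = 4 * x 2 / d := by
      rw [h0, h1, h2]; field_simp; rw [hdd]; ring
    ext k
    simp only [jInv, e, e']
    fin_cases k
    · simp [h0]; field_simp; ring
    · simp [h1]; field_simp; ring
    · simp; field_simp

theorem j_jInv {y : E3} (hy : y ∈ upper) : jInv y ∈ disc ∧ j (jInv y) = y := by
  have hy : 0 < y 2 := hy
  have hd : 0 < y 0 ^ 2 + y 1 ^ 2 + (1 + y 2) ^ 2 := by positivity
  set d := y 0 ^ 2 + y 1 ^ 2 + (1 + y 2) ^ 2 with hdd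
  have h0 : jInv y 0 = 2 * y 0 / d := rfl
  have h1 : jInv y 1 = 2 * y 1 / d := rfl
  have h2 : jInv y 2 = (y 0 ^ 2 + y 1 ^ 2 + y 2 ^ 2 - 1) / d := rfl
  have e : (jInv y 0) ^ 2 + (jInv y 1) ^ 2 + (1 - jInv y 2) ^ 2 = 4 / d := by
    rw [h0, h1, h2]; field_simp; rw [hdd]; ring
  have e' : 1 - ((jInv y 0) ^ 2 + (jInv y 1) ^ 2 + (jInv y 2) ^ 2) = 4 * y 2 / d := by
    rw [h0, h1, h2]; field_simp; rw [hdd]; ring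
  refine ⟨?_, ?_⟩
  · have : ‖jInv y‖ ^ 2 < 1 := by
      rw [norm_sq_E3]
      have : 0 < 4 * y 2 / d := by positivity
      linarith
    exact (sq_lt_one_iff₀ (norm_nonneg _)).1 this
  · ext k
    simp only [j, e, e']
    fin_cases k
    · simp [h0]; field_simp; ring
    · simp [h1]; field_simp; ring
    · simp; field_simp

theorem differentiableAt_j {x : E3} (hx : x 0 ^ 2 + x 1 ^ 2 + (1 - x 2) ^ 2 ≠ 0) :
    DifferentiableAt ℝ j x := by
  rw [differentiableAt_euclidean]
  intro k
  have hd : DifferentiableAt ℝ (fun y : E3 => y 0 ^ 2 + y 1 ^ 2 + (1 - y 2) ^ 2) x := by fun_prop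
  have h0 : DifferentiableAt ℝ (fun y : E3 => 2 * y 0) x := by fun_prop
  have h1 : DifferentiableAt ℝ (fun y : E3 => 2 * y 1) x := by fun_prop
  have h2 : DifferentiableAt ℝ (fun y : E3 => 1 - (y 0 ^ 2 + y 1 ^ 2 + y 2 ^ 2)) x := by fun_prop
  fin_cases k
  · have := h0.fun_mul (hd.fun_inv hx)
    exact this
  · have := h1.fun_mul (hd.fun_inv hx)
    exact this
  · have := h2.fun_mul (hd.fun_inv hx)
    exact this

/-- The map `j` preserves the hyperbolic metrics. -/
theorem j_isometry {x : E3} (hx : x ∈ disc) (v : E3) :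
    ‖fderiv ℝ j x v‖ ^ 2 / (j x 2) ^ 2 = 4 * ‖v‖ ^ 2 / (1 - ‖x‖ ^ 2) ^ 2 := by
  obtain ⟨hd, hlt⟩ := disc_pos hx
  have hl : HasDerivAt (fun t : ℝ => x + t • v) v 0 := by
    simpa using ((hasDerivAt_id (0 : ℝ)).smul_const v).const_add x
  have hj : HasDerivAt (fun t : ℝ => j (x + t • v)) (fderiv ℝ j x v) 0 := by
    have h1 : HasFDerivAt j (fderiv ℝ j x) (x + (0 : ℝ) • v) := by
      simpa using (differentiableAt_j hd.ne').hasFDerivAt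
    exact h1.comp_hasDerivAt 0 hl
  have hjk : ∀ k, HasDerivAt (fun t : ℝ => j (x + t • v) k) (fderiv ℝ j x v k) 0 := fun k =>
    ((EuclideanSpace.proj k : E3 →L[ℝ] ℝ).hasFDerivAt).comp_hasDerivAt 0 hj
  have c : ∀ k, HasDerivAt (fun t : ℝ => x k + t * v k) (v k) 0 := fun k => by
    simpa using ((hasDerivAt_id (0 : ℝ)).mul_const (v k)).const_add (x k)
  have cd := (((c 0).pow 2).add ((c 1).pow 2)).add (((c 2).const_sub 1).pow 2)
  have cr := ((((c 0).pow 2).add ((c 1).pow 2)).add ((c 2).pow 2)).const_sub 1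
  have hne : (x 0 + 0 * v 0) ^ 2 + (x 1 + 0 * v 1) ^ 2 + (1 - (x 2 + 0 * v 2)) ^ 2 ≠ 0 := by
    simpa using hd.ne'
  have u0 := (hjk 0).unique (((c 0).const_mul 2).div cd hne)
  have u1 := (hjk 1).unique (((c 1).const_mul 2).div cd hne)
  have u2 := (hjk 2).unique (cr.div cd hne)
  simp at u0 u1 u2
  have h2 : j x 2 = (1 - (x 0 ^ 2 + x 1 ^ 2 + x 2 ^ 2)) /
    (x 0 ^ 2 + x 1 ^ 2 + (1 - x 2) ^ 2) := rfl
  have hlt' : 1 - (x 0 ^ 2 + x 1 ^ 2 + x 2 ^ 2) ≠ 0 := by linarith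
  rw [norm_sq_E3, norm_sq_E3, norm_sq_E3, u0, u1, u2, h2]
  have hd' := hd.ne'
  field_simp
  ring

/-- The map `j` extends continuously to stereographic projection on the sphere at infinity. -/
theorem j_tendsto_bdry {b : E3} (hb : ‖b‖ = 1) (z : ℂ) (hz : jBdry b = z) :
    Filter.Tendsto j (𝓝 b) (𝓝 !₂[z.re, z.im, 0]) := by
  have hn : b 0 ^ 2 + b 1 ^ 2 + b 2 ^ 2 = 1 := by
    rw [← norm_sq_E3, hb, one_pow]
  have hb' : b ≠ !₂[0, 0, 1] := by
    rintro rfl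
    simp [jBdry] at hz
  rw [jBdry, if_neg hb', OnePoint.coe_eq_coe] at hz
  have h2 : 1 - b 2 ≠ 0 := by
    intro h
    have h2 : b 2 = 1 := by linarith
    rw [h2] at hn
    have h0 : b 0 = 0 := by nlinarith [sq_nonneg (b 0), sq_nonneg (b 1)]
    have h1 : b 1 = 0 := by nlinarith [sq_nonneg (b 0), sq_nonneg (b 1)]
    apply hb'
    ext k
    fin_cases k <;> simp [h0, h1, h2]
  have hd : b 0 ^ 2 + b 1 ^ 2 + (1 - b 2) ^ 2 = 2 * (1 - b 2) := by linear_combination hn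
  have hd' : b 0 ^ 2 + b 1 ^ 2 + (1 - b 2) ^ 2 ≠ 0 := by
    rw [hd]
    exact mul_ne_zero two_ne_zero h2
  have hz' : z = ⟨b 0 / (1 - b 2), b 1 / (1 - b 2)⟩ := by
    have h2' : (1 : ℂ) - (b 2 : ℂ) ≠ 0 := fun h => h2 (by simpa using congrArg Complex.re h)
    rw [← hz, div_eq_iff h2']
    apply Complex.ext <;> simp <;> field_simp
  have : j b = !₂[z.re, z.im, 0] := by
    ext k
    fin_cases k <;> simp [j, hd, hz', hn] <;> field_simp
  rw [← this]
  exact (differentiableAt_j hd').continuousAt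

/-- The map `j` sends the north pole of the sphere at infinity to `∞`. -/
theorem j_tendsto_infty :
    Filter.Tendsto (fun x => ‖j x‖) (𝓝[disc] !₂[0, 0, 1]) Filter.atTop := by
  rw [Filter.tendsto_atTop]
  intro B
  have hc : Continuous fun x : E3 => x 0 ^ 2 + x 1 ^ 2 + (1 - x 2) ^ 2 := by fun_prop
  have ht : Filter.Tendsto (fun x : E3 => x 0 ^ 2 + x 1 ^ 2 + (1 - x 2) ^ 2)
      (𝓝[disc] !₂[0, 0, 1]) (𝓝 0) := by
    have := (hc.tendsto !₂[0, 0, 1]).mono_left (nhdsWithin_le_nhds (s := disc))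
    simpa using this
  have hB : 0 < 4 / (|B| + 1) ^ 2 := by positivity
  filter_upwards [ht.eventually_lt_const hB, self_mem_nhdsWithin] with x hxB hx
  obtain ⟨hd, -⟩ := disc_pos hx
  set d := x 0 ^ 2 + x 1 ^ 2 + (1 - x 2) ^ 2 with hdd
  have h0 : j x 0 = 2 * x 0 / d := rfl
  have h1 : j x 1 = 2 * x 1 / d := rfl
  have h2 : j x 2 = (1 - (x 0 ^ 2 + x 1 ^ 2 + x 2 ^ 2)) / d := rfl
  have e : ‖j x‖ ^ 2 + 2 * j x 2 + 1 = 4 / d := by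
    rw [norm_sq_E3, h0, h1, h2]; field_simp; rw [hdd]; ring
  have h3 : j x 2 ≤ ‖j x‖ := by
    refine le_of_sq_le_sq ?_ (norm_nonneg _)
    rw [norm_sq_E3]
    nlinarith [sq_nonneg (j x 0), sq_nonneg (j x 1)]
  have h4 : (|B| + 1) ^ 2 < 4 / d := by
    rw [lt_div_iff₀ (by positivity)] at hxB
    rw [lt_div_iff₀ hd]
    linarith
  have h5 : (|B| + 1) ^ 2 < (‖j x‖ + 1) ^ 2 := by linarith
  have h6 := lt_of_pow_lt_pow_left₀ 2 (by positivity) h5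
  linarith [le_abs_self B]

/-! ### The action of `SL(2, ℂ)` on the upper half space -/

/-- The action on the disc model, transported from the hyperboloid model. -/
def discAct (A : SpecialLinearGroup (Fin 2) ℂ) (x : E3) : E3 := i (minkAct A (iInv x))

/-- The action on the upper half space model, transported from the disc model. -/
def upperAct (A : SpecialLinearGroup (Fin 2) ℂ) (x : E3) : E3 := j (discAct A (jInv x))

/-- Parabolic elements. -/
def IsParabolic (A : SpecialLinearGroup (Fin 2) ℂ) : Prop := A.1.trace = 2 ∨ A.1.trace = -2

/-! ### Decorated horospheres in the upper half space -/

/-- Horospheres in the upper half space. -/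
def IsHorosphere (s : Set E3) : Prop := ∃ s₀, IsHorosphereHyp s₀ ∧ s = j '' (i '' s₀)

/-- `c ∈ ℂ ∪ {∞}` is the centre of the horosphere `s` in the upper half space. -/
def IsCentre (s : Set E3) (c : OnePoint ℂ) : Prop :=
  ∃ s₀ p, IsCentreHyp s₀ p ∧ s = j '' (i '' s₀) ∧ c = jBdry (iBdry p)

/-- A line field on a horosphere is parallel if it is invariant under the parabolic isometries that
preserve the horosphere. -/
def IsParallel (X : DirectedSet E3) : Prop :=
  ∀ A : SpecialLinearGroup (Fin 2) ℂ, IsParabolic A → upperAct A '' X.carrier = X.carrier →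
    X.push (upperAct A) = X

/-- Decorated horospheres: horospheres with a parallel oriented line field. (A parallel line field
is automatically smooth, as the parabolic isometries act simply transitively.) -/
def IsDecoratedHorosphere (X : DirectedSet E3) : Prop :=
  IsHorosphere X.carrier ∧ X.IsOrientedLineField ∧ IsParallel X

/-- The horizontal tangent vector given by a complex number. -/
def horizontal (α : ℂ) : E3 := !₂[α.re, α.im, 0]

/-- `n` is the highest point of `s`. -/
def IsNorthPole (s : Set E3) (n : E3) : Prop := n ∈ s ∧ ∀ q ∈ s, q ≠ n → q 2 < n 2

/-- `α` is a specification of the decoration of a horosphere centred at `∞`: it directs the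
oriented line at every point. -/
def IsSpecification (X : DirectedSet E3) (α : ℂ) : Prop :=
  ∀ q ∈ X.carrier, horizontal α ∈ X.dir q

/-- `α` is a north-pole specification of the decoration of a horosphere not centred at `∞`. -/
def IsNorthPoleSpecification (X : DirectedSet E3) (α : ℂ) : Prop :=
  ∃ n, IsNorthPole X.carrier n ∧ horizontal α ∈ X.dir n

/-! ### The maps from spinors to horospheres and decorated horospheres -/

/-- The horosphere of a nonzero spinor, `k = j ∘ i ∘ h ∘ g ∘ f`. -/
def k (κ : Fin 2 → ℂ) : Set E3 := j '' (i '' h (g (f κ)))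

/-- The decorated horosphere of a nonzero spinor, `K = J ∘ I ∘ H ∘ G ∘ F`, where `I` and `J` are
given by the isometries `i`, `j` and their derivatives. -/
def K (κ : Fin 2 → ℂ) (hκ : κ ≠ 0) : DirectedSet E3 :=
  ((H (G (F κ hκ))).push i).push j

end SpinorHorosphere

end

/-! The flag `[[p, v]]` decorates `h p` at `q` by the direction of `v - ⟨v, q⟩ p`, the vector of
`v + ℝ p` tangent to the hyperboloid at `q`.

The construction is `SL(2, ℂ)`-equivariant. Indeed `A` carries the derivative of `f` at `κ` along
`ν` to the one at `A κ` along `A ν`, and up to multiples of `f κ` this derivative depends only on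
the value of the invariant symplectic form at `(κ, ν)`; since the form is a positive multiple of
`-i` at `(κ, Z κ)` for every `κ`, flags go to flags. A parabolic map preserving the horosphere of
`κ` has `κ` as an eigenvector, with eigenvalue `±1`, and `K (-κ) = K κ`, so the decoration is
parallel.

In the upper half space, at the point of `K (ξ, η)` over `ζ` at height `z`, the direction above has
horizontal part `i ((ξ - η ζ)² + (η̄ z)²)` and vertical part `2 z Im ((ξ - η ζ) η)`, up to a
positive factor. For `η = 0` this is `i ξ²`, and at the north pole, where `ζ = ξ / η` and
`z = |η|⁻²`, it is `i η⁻²`. -/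

noncomputable section

namespace SpinorHorosphere

/-! ### Transport of tangent vectors and line fields -/

section Transport

variable {E E' E'' : Type*} [NormedAddCommGroup E] [NormedSpace ℝ E] [NormedAddCommGroup E']
  [NormedSpace ℝ E'] [NormedAddCommGroup E''] [NormedSpace ℝ E'']

theorem fderiv_mem_tangentVectors {φ : E → E'} {M : Set E} {N : Set E'} {x v : E}
    (hφ : Set.MapsTo φ M N) (hd : DifferentiableAt ℝ φ x) (hv : v ∈ tangentVectors M x) :
    fderiv ℝ φ x v ∈ tangentVectors N (φ x) := by
  obtain ⟨γ, rfl, hm, hγ⟩ := hv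
  exact ⟨φ ∘ γ, rfl, hm.mono fun t ht => hφ ht, hd.hasFDerivAt.comp_hasDerivAt 0 hγ⟩

theorem fderiv_eq_of_eqOn {φ ψ : E → E'} {M : Set E} {x v : E} (hM : Set.EqOn φ ψ M)
    (hφ : DifferentiableAt ℝ φ x) (hψ : DifferentiableAt ℝ ψ x) (hv : v ∈ tangentVectors M x) :
    fderiv ℝ φ x v = fderiv ℝ ψ x v := by
  obtain ⟨γ, rfl, hm, hγ⟩ := hv
  exact (hφ.hasFDerivAt.comp_hasDerivAt 0 hγ).unique
    ((hψ.hasFDerivAt.comp_hasDerivAt 0 hγ).congr_of_eventuallyEq (hm.mono fun t ht => hM ht))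

theorem smul_mem_tangentVectors (c : ℝ) {M : Set E} {x v : E} (hv : v ∈ tangentVectors M x) :
    c • v ∈ tangentVectors M x := by
  obtain ⟨γ, rfl, hm, hγ⟩ := hv
  have hc : HasDerivAt (fun t : ℝ => c * t) c 0 := by
    simpa using (hasDerivAt_id (0 : ℝ)).const_mul c
  have hc0 : Filter.Tendsto (fun t : ℝ => c * t) (𝓝 0) (𝓝 0) := by
    simpa using hc.continuousAt.tendsto
  exact ⟨fun t => γ (c * t), by simp, hc0.eventually hm, (hγ.scomp_of_eq 0 hc (by simp))⟩

/-- The open ray spanned by `v`, the encoding of an oriented line in a `DirectedSet`. -/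
def openRay (v : E) : Set E := {w | ∃ c : ℝ, 0 < c ∧ w = c • v}

theorem self_mem_openRay (v : E) : v ∈ openRay v := ⟨1, one_pos, (one_smul ℝ v).symm⟩

theorem openRay_smul {c : ℝ} (hc : 0 < c) (v : E) : openRay (c • v) = openRay v := by
  ext w
  constructor
  · rintro ⟨b, hb, rfl⟩
    exact ⟨b * c, mul_pos hb hc, smul_smul b c v⟩
  · rintro ⟨b, hb, rfl⟩
    exact ⟨b / c, div_pos hb hc, by rw [smul_smul, div_mul_cancel₀ b hc.ne']⟩

theorem image_openRay (L : E →L[ℝ] E') (v : E) : L '' openRay v = openRay (L v) := by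
  ext w
  constructor
  · rintro ⟨_, ⟨c, hc, rfl⟩, rfl⟩
    exact ⟨c, hc, map_smul L c v⟩
  · rintro ⟨c, hc, rfl⟩
    exact ⟨c • v, ⟨c, hc, rfl⟩, map_smul L c v⟩

namespace DirectedSet

variable {X : DirectedSet E}

theorem push_push {φ : E → E'} {ψ : E' → E''} (hφ : ∀ x ∈ X.carrier, DifferentiableAt ℝ φ x)
    (hψ : ∀ x ∈ X.carrier, DifferentiableAt ℝ ψ (φ x)) :
    (X.push φ).push ψ = X.push (ψ ∘ φ) := by
  have hd : ∀ q ∈ X.carrier, ∀ v, fderiv ℝ (ψ ∘ φ) q v = fderiv ℝ ψ (φ q) (fderiv ℝ φ q v) :=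
    fun q hq v => by rw [fderiv_comp q (hψ q hq) (hφ q hq)]; rfl
  ext y w
  · simp only [push, Set.image_image, Function.comp_apply]
  · constructor
    · rintro ⟨_, -, rfl, _, ⟨q, hq, rfl, v, hv, rfl⟩, rfl⟩
      exact ⟨q, hq, rfl, v, hv, (hd q hq v).symm⟩
    · rintro ⟨q, hq, rfl, v, hv, rfl⟩
      exact ⟨φ q, Set.mem_image_of_mem φ hq, rfl, _, ⟨q, hq, rfl, v, hv, rfl⟩, hd q hq v⟩

theorem IsOrientedLineField.dir_subset_tangentVectors (hX : X.IsOrientedLineField) (q : E) :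
    X.dir q ⊆ tangentVectors X.carrier q := by
  intro v hv
  have hq : q ∈ X.carrier := by
    by_contra hq
    simp [hX.2 q hq] at hv
  obtain ⟨u, hu, -, hdir⟩ := hX.1 q hq
  obtain ⟨c, -, rfl⟩ := hdir ▸ hv
  exact smul_mem_tangentVectors c hu

theorem IsOrientedLineField.ext {Y : DirectedSet E} (hX : X.IsOrientedLineField)
    (hY : Y.IsOrientedLineField) (hXY : X.carrier = Y.carrier)
    (hdir : ∀ q ∈ X.carrier, X.dir q = Y.dir q) : X = Y := by
  refine DirectedSet.ext hXY (funext fun q => ?_)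
  by_cases hq : q ∈ X.carrier
  · exact hdir q hq
  · rw [hX.2 q hq, hY.2 q (hXY ▸ hq)]

theorem IsOrientedLineField.push_congr (hX : X.IsOrientedLineField) {φ ψ : E → E'}
    (h : Set.EqOn φ ψ X.carrier) (hφ : ∀ x ∈ X.carrier, DifferentiableAt ℝ φ x)
    (hψ : ∀ x ∈ X.carrier, DifferentiableAt ℝ ψ x) : X.push φ = X.push ψ := by
  have hd : ∀ q ∈ X.carrier, ∀ v ∈ X.dir q, fderiv ℝ φ q v = fderiv ℝ ψ q v :=
    fun q hq v hv => fderiv_eq_of_eqOn h (hφ q hq) (hψ q hq) (hX.dir_subset_tangentVectors q hv)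
  ext y w
  · simp only [push, h.image_eq]
  · constructor
    · rintro ⟨q, hq, rfl, v, hv, rfl⟩
      exact ⟨q, hq, (h hq).symm, v, hv, hd q hq v hv⟩
    · rintro ⟨q, hq, rfl, v, hv, rfl⟩
      exact ⟨q, hq, h hq, v, hv, (hd q hq v hv).symm⟩

theorem dir_push_of_injOn {φ : E → E'} (hφ : Set.InjOn φ X.carrier) {q : E} (hq : q ∈ X.carrier) :
    (X.push φ).dir (φ q) = fderiv ℝ φ q '' X.dir q := by
  ext w
  constructor
  · rintro ⟨q', hq', e, v, hv, rfl⟩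
    obtain rfl := hφ hq' hq e
    exact ⟨v, hv, rfl⟩
  · rintro ⟨v, hv, rfl⟩
    exact ⟨q, hq, rfl, v, hv, rfl⟩

/-- A differentiable left inverse of the transporting map keeps the directions nonzero. -/
theorem IsOrientedLineField.push (hX : X.IsOrientedLineField) {φ : E → E'} {ψ : E' → E}
    (hφ : ∀ x ∈ X.carrier, DifferentiableAt ℝ φ x)
    (hψ : ∀ x ∈ X.carrier, DifferentiableAt ℝ ψ (φ x)) (hψφ : Set.LeftInvOn ψ φ X.carrier) :
    (X.push φ).IsOrientedLineField := by
  refine ⟨?_, fun y hy => Set.eq_empty_of_forall_notMem ?_⟩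
  · rintro _ ⟨q, hq, rfl⟩
    obtain ⟨v, hv, hv0, hdir⟩ := hX.1 q hq
    refine ⟨fderiv ℝ φ q v, fderiv_mem_tangentVectors (Set.mapsTo_image φ _) (hφ q hq) hv, ?_, ?_⟩
    · have hinv : fderiv ℝ ψ (φ q) (fderiv ℝ φ q v) = v := by
        rw [← ContinuousLinearMap.comp_apply, ← fderiv_comp q (hψ q hq) (hφ q hq),
          fderiv_eq_of_eqOn (φ := ψ ∘ φ) (ψ := id) hψφ ((hψ q hq).comp q (hφ q hq))
            differentiableAt_id hv,
          fderiv_id, ContinuousLinearMap.id_apply]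
      intro h0
      exact hv0 (by rw [← hinv, h0, map_zero])
    · rw [dir_push_of_injOn hψφ.injOn hq, hdir]
      exact image_openRay (fderiv ℝ φ q) v
  · rintro _ ⟨q, hq, rfl, -⟩
    exact hy (Set.mem_image_of_mem φ hq)

end DirectedSet

end Transport

/-! ### The Minkowski form -/

theorem mink_comm (p q : Mink) : mink p q = mink q p := by
  simp only [mink]; ring

theorem mink_add_left (p p' q : Mink) : mink (p + p') q = mink p q + mink p' q := by
  simp only [mink, Pi.add_apply]; ring

theorem mink_sub_left (p p' q : Mink) : mink (p - p') q = mink p q - mink p' q := by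
  simp only [mink, Pi.sub_apply]; ring

theorem mink_smul_left (c : ℝ) (p q : Mink) : mink (c • p) q = c * mink p q := by
  simp only [mink, Pi.smul_apply, smul_eq_mul]; ring

theorem mink_add_right (p q q' : Mink) : mink p (q + q') = mink p q + mink p q' := by
  simp only [mink_comm p, mink_add_left]

theorem mink_sub_right (p q q' : Mink) : mink p (q - q') = mink p q - mink p q' := by
  simp only [mink_comm p, mink_sub_left]

theorem mink_smul_right (c : ℝ) (p q : Mink) : mink p (c • q) = c * mink p q := by
  simp only [mink_comm p, mink_smul_left]

theorem hasDerivAt_mink {γ δ : ℝ → Mink} {u w : Mink} {t : ℝ} (hγ : HasDerivAt γ u t)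
    (hδ : HasDerivAt δ w t) :
    HasDerivAt (fun s => mink (γ s) (δ s)) (mink u (δ t) + mink (γ t) w) t := by
  rw [hasDerivAt_pi] at hγ hδ
  refine (((((hγ 0).mul (hδ 0)).sub ((hγ 1).mul (hδ 1))).sub ((hγ 2).mul (hδ 2))).sub
    ((hγ 3).mul (hδ 3))).congr_deriv ?_
  simp only [mink]; ring

theorem mink_eq_zero_of_mem_tangentVectors {M : Set Mink} {p x v : Mink} {c : ℝ}
    (hM : ∀ y ∈ M, mink y p = c) (hv : v ∈ tangentVectors M x) : mink v p = 0 := by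
  obtain ⟨γ, rfl, hm, hγ⟩ := hv
  simpa [mink] using (hasDerivAt_mink hγ (hasDerivAt_const (0 : ℝ) p)).unique
    ((hasDerivAt_const (0 : ℝ) c).congr_of_eventuallyEq (hm.mono fun t ht => hM _ ht))

theorem mink_self_eq_zero_of_mem_tangentVectors {M : Set Mink} {x v : Mink} {c : ℝ}
    (hM : ∀ y ∈ M, mink y y = c) (hv : v ∈ tangentVectors M x) : mink v x = 0 := by
  obtain ⟨γ, rfl, hm, hγ⟩ := hv
  have := (hasDerivAt_mink hγ hγ).unique
    ((hasDerivAt_const (0 : ℝ) c).congr_of_eventuallyEq (hm.mono fun t ht => hM _ ht))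
  rw [mink_comm (γ 0) v] at this
  linarith

/-- The Cauchy–Schwarz inequality for the spatial parts. -/
theorem sq_sub_mink_le (p q : Mink) :
    (p 0 * q 0 - mink p q) ^ 2 ≤ (p 0 ^ 2 - mink p p) * (q 0 ^ 2 - mink q q) := by
  have := Finset.sum_mul_sq_le_sq_mul_sq Finset.univ ![p 1, p 2, p 3] ![q 1, q 2, q 3]
  simp only [Fin.sum_univ_three, cons_val_zero, cons_val_one, cons_val] at this
  calc (p 0 * q 0 - mink p q) ^ 2 = (p 1 * q 1 + p 2 * q 2 + p 3 * q 3) ^ 2 := by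
        simp only [mink]; ring
    _ ≤ _ := this
    _ = (p 0 ^ 2 - mink p p) * (q 0 ^ 2 - mink q q) := by simp only [mink]; ring

theorem mink_self_lt_zero {q u : Mink} (hq : q ∈ hyperboloid) (hu : u ≠ 0) (huq : mink u q = 0) :
    mink u u < 0 := by
  have hcs := sq_sub_mink_le u q
  rw [huq, hq.1] at hcs
  by_contra! hm
  have hq1 : 1 ≤ q 0 ^ 2 := by
    have := hq.1
    simp only [mink] at this
    nlinarith [sq_nonneg (q 1), sq_nonneg (q 2), sq_nonneg (q 3)]
  have hu0 : u 0 = 0 := by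
    rw [← sq_eq_zero_iff]
    nlinarith [sq_nonneg (u 0)]
  simp only [mink, hu0] at hm
  refine hu ?_
  ext m
  fin_cases m
  · exact hu0
  all_goals
    rw [Pi.zero_apply, ← sq_eq_zero_iff]
    simp only [Fin.isValue, Fin.mk_one, Fin.reduceFinMk]
    nlinarith [sq_nonneg (u 1), sq_nonneg (u 2), sq_nonneg (u 3)]

theorem mink_pos_iff {x p : Mink} (hx : mink x x = 1) (hp : p ∈ lightCone) :
    0 < mink x p ↔ 0 < x 0 := by
  have hcs := sq_sub_mink_le x p
  have hp0 := hp.2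
  rw [hx, hp.1] at hcs
  have habs : |x 0 * p 0 - mink x p| < |x 0 * p 0| := by
    rw [← sq_lt_sq]
    nlinarith [pow_pos hp0 2]
  constructor <;> intro hpos
  · by_contra! hx0
    rw [abs_of_nonpos (mul_nonpos_of_nonpos_of_nonneg hx0 hp0.le)] at habs
    linarith [neg_abs_le (x 0 * p 0 - mink x p)]
  · rw [abs_of_pos (mul_pos hpos hp0)] at habs
    linarith [le_abs_self (x 0 * p 0 - mink x p)]

theorem lagrange_lightCone {p q : Mink} (hp : p ∈ lightCone) (hq : q ∈ lightCone) :
    2 * (p 0 * q 0) * mink p q = (q 0 * p 1 - p 0 * q 1) ^ 2 + (q 0 * p 2 - p 0 * q 2) ^ 2 +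
      (q 0 * p 3 - p 0 * q 3) ^ 2 := by
  have hp := hp.1
  have hq := hq.1
  simp only [mink] at *
  linear_combination q 0 ^ 2 * hp + p 0 ^ 2 * hq

theorem mink_nonneg {p q : Mink} (hp : p ∈ lightCone) (hq : q ∈ lightCone) : 0 ≤ mink p q := by
  have h0 : 0 < 2 * (p 0 * q 0) := mul_pos two_pos (mul_pos hp.2 hq.2)
  refine nonneg_of_mul_nonneg_right ?_ h0
  rw [lagrange_lightCone hp hq]
  positivity

theorem sameRay_of_mink_eq_zero {p q : Mink} (hp : p ∈ lightCone) (hq : q ∈ lightCone)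
    (hpq : mink p q = 0) : SameRay ℝ p q := by
  have hsum := lagrange_lightCone hp hq
  rw [hpq, mul_zero] at hsum
  refine Or.inr (Or.inr ⟨q 0, p 0, hq.2, hp.2, ?_⟩)
  ext m
  rw [Pi.smul_apply, Pi.smul_apply, smul_eq_mul, smul_eq_mul, ← sub_eq_zero]
  fin_cases m
  · exact sub_eq_zero.2 (mul_comm _ _)
  all_goals
    rw [← sq_eq_zero_iff]
    simp only [Fin.isValue, Fin.mk_one, Fin.reduceFinMk]
    nlinarith [sq_nonneg (q 0 * p 1 - p 0 * q 1), sq_nonneg (q 0 * p 2 - p 0 * q 2),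
      sq_nonneg (q 0 * p 3 - p 0 * q 3)]

/-! ### Horospheres in the hyperboloid -/

theorem mem_h_iff {p x : Mink} (hp : p ∈ lightCone) : x ∈ h p ↔ mink x x = 1 ∧ mink x p = 1 :=
  ⟨fun hx => ⟨hx.1.1, hx.2⟩, fun hx =>
    ⟨⟨hx.1, (mink_pos_iff hx.1 hp).1 (hx.2 ▸ one_pos)⟩, hx.2⟩⟩

theorem h_nonempty {p : Mink} (hp : p ∈ lightCone) : (h p).Nonempty := by
  set p' : Mink := ![p 0, -p 1, -p 2, -p 3]
  have hp' : mink p' p' = 0 := by simpa [p', mink] using hp.1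
  have hpp' : mink p' p ≠ 0 := by
    have : mink p' p = 2 * p 0 ^ 2 := by
      have := hp.1
      simp only [mink] at this
      simp only [mink, p', cons_val]
      linear_combination -this
    rw [this]
    exact mul_ne_zero two_ne_zero (pow_ne_zero 2 hp.2.ne')
  refine ⟨(1 / 2 : ℝ) • p + (mink p' p)⁻¹ • p', (mem_h_iff hp).2 ⟨?_, ?_⟩⟩
  · simp only [mink_add_left, mink_add_right, mink_smul_left, mink_smul_right, mink_comm p p', hp',
      hp.1]
    field_simp
    ring
  · simp only [mink_add_left, mink_smul_left, hp.1]
    field_simp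
    ring

theorem isLightlikePlane_of_mem_lightCone {p : Mink} (hp : p ∈ lightCone) (c : ℝ) :
    IsLightlikePlane {x | mink x p = c} :=
  ⟨p, fun h0 => by simpa [h0] using hp.2, hp.1, c, rfl⟩

theorem isHorosphereHyp_h {p : Mink} (hp : p ∈ lightCone) : IsHorosphereHyp (h p) :=
  ⟨h_nonempty hp, _, isLightlikePlane_of_mem_lightCone hp 1, rfl⟩

theorem isCentreHyp_h {p : Mink} (hp : p ∈ lightCone) : IsCentreHyp (h p) p := by
  refine ⟨h_nonempty hp, hp, _, isLightlikePlane_of_mem_lightCone hp 1, rfl, fun p' hp' => ?_⟩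
  constructor
  · intro hmiss
    refine sameRay_of_mink_eq_zero hp' hp (by_contra fun hne => ?_)
    refine hmiss (mink p' p)⁻¹ (inv_pos.2 ((mink_nonneg hp' hp).lt_of_ne' hne)) ?_
    change mink ((mink p' p)⁻¹ • p') p = 1
    rw [mink_smul_left, inv_mul_cancel₀ hne]
  · intro hray t _ hmem
    obtain ⟨r, -, rfl⟩ := hray.exists_nonneg_right (fun h0 => by simpa [h0] using hp.2)
    simp [mink_smul_left, hp.1] at hmem

theorem horocycle_mem_h {p q u : Mink} (hp : p ∈ lightCone) (hq : q ∈ h p) (huq : mink u q = 0)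
    (hup : mink u p = 0) (t : ℝ) : q + t • u - (t ^ 2 * mink u u / 2) • p ∈ h p := by
  rw [mem_h_iff hp]
  simp only [mink_add_left, mink_add_right, mink_sub_left, mink_sub_right, mink_smul_left,
    mink_smul_right, mink_comm q u, mink_comm p q, mink_comm p u, huq, hup, hp.1, hq.1.1, hq.2]
  constructor <;> ring

theorem hasDerivAt_horocycle (p q u : Mink) (c : ℝ) :
    HasDerivAt (fun t : ℝ => q + t • u - (t ^ 2 * c / 2) • p) u 0 := by
  have h1 : HasDerivAt (fun t : ℝ => q + t • u) u 0 := by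
    simpa using ((hasDerivAt_id (0 : ℝ)).smul_const u).const_add q
  have h2 : HasDerivAt (fun t : ℝ => (t ^ 2 * c / 2) • p) 0 0 := by
    simpa using ((((hasDerivAt_pow 2 (0 : ℝ)).mul_const c).div_const 2).smul_const p)
  simpa using h1.fun_sub h2

theorem mem_tangentVectors_h_iff {p q u : Mink} (hp : p ∈ lightCone) (hq : q ∈ h p) :
    u ∈ tangentVectors (h p) q ↔ mink u q = 0 ∧ mink u p = 0 :=
  ⟨fun hu => ⟨mink_self_eq_zero_of_mem_tangentVectors (fun _ hy => hy.1.1) hu,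
    mink_eq_zero_of_mem_tangentVectors (fun _ hy => hy.2) hu⟩,
   fun hu => ⟨_, by simp, .of_forall (horocycle_mem_h hp hq hu.1 hu.2),
    hasDerivAt_horocycle p q u _⟩⟩

theorem mink_eq_zero_of_h_subset {p p' q u : Mink} (hp : p ∈ lightCone) (hq : q ∈ h p)
    (hu : u ∈ tangentVectors (h p) q) (hu0 : u ≠ 0) (hsub : h p ⊆ h p') : mink p p' = 0 := by
  obtain ⟨huq, hup⟩ := (mem_tangentVectors_h_iff hp hq).1 hu
  have huu := (mink_self_lt_zero hq.1 hu0 huq).ne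
  have h1 := (hsub (horocycle_mem_h hp hq huq hup 1)).2
  have h2 := (hsub (horocycle_mem_h hp hq huq hup (-1))).2
  simp only [mink_sub_left, mink_add_left, mink_smul_left, (hsub hq).2] at h1 h2
  have : mink u u * mink p p' = 0 := by linear_combination -h1 - h2
  exact (mul_eq_zero.1 this).resolve_left huu

/-! ### The decoration of a flag -/

namespace Flag

variable {E : Type*} [NormedAddCommGroup E] [NormedSpace ℝ E] {C : Set E} (Φ : Flag C)

theorem pos_nonempty : Φ.pos.Nonempty := by
  obtain ⟨v, -, -, -, hpos⟩ := Φ.exists_rep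
  exact ⟨v, hpos ▸ ⟨0, 1, one_pos, by simp⟩⟩

theorem pos_eq {v : E} (hv : v ∈ Φ.pos) : Φ.pos = openHalfPlane Φ.point v := by
  obtain ⟨v₀, -, -, -, hpos⟩ := Φ.exists_rep
  rw [hpos] at hv ⊢
  obtain ⟨a, b, hb, rfl⟩ := hv
  ext w
  constructor
  · rintro ⟨a', b', hb', rfl⟩
    refine ⟨a' - b' / b * a, b' / b, div_pos hb' hb, ?_⟩
    rw [smul_add, smul_smul, smul_smul, div_mul_cancel₀ _ hb.ne']
    module
  · rintro ⟨a', b', hb', rfl⟩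
    exact ⟨a' + b' * a, b' * b, mul_pos hb' hb, by module⟩

theorem pos_subset_plane : Φ.pos ⊆ Φ.plane := by
  obtain ⟨v, -, -, hplane, hpos⟩ := Φ.exists_rep
  rw [hplane, hpos]
  rintro _ ⟨a, b, -, rfl⟩
  exact Submodule.mem_span_pair.2 ⟨a, b, rfl⟩

theorem ne_smul_point {v : E} (hv : v ∈ Φ.pos) (c : ℝ) : v ≠ c • Φ.point := by
  obtain ⟨v₀, -, hli, -, hpos⟩ := Φ.exists_rep
  rw [hpos] at hv
  obtain ⟨a, b, hb, rfl⟩ := hv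
  intro h0
  refine hb.ne' (LinearIndependent.pair_iff.1 hli (a - c) b ?_).2
  rw [sub_smul, ← h0]
  module

theorem mink_point_eq_zero (Φ : Flag lightCone) {v : Mink} (hv : v ∈ Φ.pos) :
    mink v Φ.point = 0 := by
  obtain ⟨v₀, hv₀, -, -, hpos⟩ := Φ.exists_rep
  rw [hpos] at hv
  obtain ⟨a, b, -, rfl⟩ := hv
  rw [mink_add_left, mink_smul_left, mink_smul_left, Φ.point_mem.1,
    mink_self_eq_zero_of_mem_tangentVectors (fun _ hy => hy.1) hv₀, mul_zero, mul_zero, add_zero]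

end Flag

/-- The direction of the decoration `H [[p, v]]` at `q`: the vector of `v + ℝ p` that is tangent to
the hyperboloid at `q ∈ h p`. -/
def horoVec (p v q : Mink) : Mink := v - mink v q • p

theorem horoVec_mem_tangentVectors {p v q : Mink} (hp : p ∈ lightCone) (hv : mink v p = 0)
    (hq : q ∈ h p) : horoVec p v q ∈ tangentVectors (h p) q := by
  rw [mem_tangentVectors_h_iff hp hq, horoVec, mink_sub_left, mink_sub_left, mink_smul_left,
    mink_smul_left, hp.1, hv, mink_comm p q, hq.2]
  constructor <;> ring

theorem dir_H (Φ : Flag lightCone) {v q : Mink} (hv : v ∈ Φ.pos) (hq : q ∈ h Φ.point) :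
    (H Φ).dir q = openRay (horoVec Φ.point v q) := by
  have hvp := Φ.mink_point_eq_zero hv
  ext w
  constructor
  · rintro ⟨-, -, hwt, hwpos⟩
    rw [Φ.pos_eq hv] at hwpos
    obtain ⟨a, b, hb, rfl⟩ := hwpos
    refine ⟨b, hb, ?_⟩
    have hwq := ((mem_tangentVectors_h_iff Φ.point_mem hq).1 hwt).1
    rw [mink_add_left, mink_smul_left, mink_smul_left, mink_comm _ q, hq.2, mul_one] at hwq
    rw [eq_neg_of_add_eq_zero_left hwq, horoVec]
    module
  · rintro ⟨c, hc, rfl⟩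
    have hpos : c • horoVec Φ.point v q ∈ Φ.pos := by
      rw [Φ.pos_eq hv]
      exact ⟨-(c * mink v q), c, hc, by rw [horoVec]; module⟩
    exact ⟨hq, Φ.pos_subset_plane hpos,
      smul_mem_tangentVectors c (horoVec_mem_tangentVectors Φ.point_mem hvp hq), hpos⟩

theorem isOrientedLineField_H (Φ : Flag lightCone) : (H Φ).IsOrientedLineField := by
  obtain ⟨v, hv⟩ := Φ.pos_nonempty
  refine ⟨fun q hq => ⟨horoVec Φ.point v q, horoVec_mem_tangentVectors Φ.point_mem
    (Φ.mink_point_eq_zero hv) hq, sub_ne_zero.2 (Φ.ne_smul_point hv _), dir_H Φ hv hq⟩,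
    fun q hq => Set.eq_empty_of_forall_notMem fun w hw => hq hw.1⟩

theorem push_H {Φ Ψ : Flag lightCone} {L : Mink ≃L[ℝ] Mink}
    (hL : ∀ x y, mink (L x) (L y) = mink x y) (hp : L Φ.point = Ψ.point) {v : Mink}
    (hv : v ∈ Φ.pos) (hLv : L v ∈ Ψ.pos) : (H Φ).push L = H Ψ := by
  have hmem : ∀ q, L q ∈ h Ψ.point ↔ q ∈ h Φ.point := fun q => by
    rw [mem_h_iff Ψ.point_mem, mem_h_iff Φ.point_mem, ← hp, hL, hL]
  refine ((isOrientedLineField_H Φ).push (ψ := L.symm) (fun _ _ => L.differentiableAt)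
    (fun _ _ => L.symm.differentiableAt) fun q _ => L.symm_apply_apply q).ext
    (isOrientedLineField_H Ψ) ?_ ?_
  · ext x
    exact ⟨fun ⟨q, hq, e⟩ => e ▸ (hmem q).2 hq, fun hx =>
      ⟨L.symm x, (hmem _).1 (by rwa [L.apply_symm_apply]), L.apply_symm_apply x⟩⟩
  · rintro _ ⟨q, hq, rfl⟩
    have hvec : L (horoVec Φ.point v q) = horoVec Ψ.point (L v) (L q) := by
      rw [horoVec, horoVec, map_sub, map_smul, hL, hp]
    rw [DirectedSet.dir_push_of_injOn L.injective.injOn hq, dir_H Φ hv hq,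
      dir_H Ψ hLv ((hmem q).2 hq), ← hvec, ContinuousLinearEquiv.fderiv]
    exact image_openRay (L : Mink →L[ℝ] Mink) _

/-! ### The hyperboloid and the upper half space -/

/-- The composite `j ∘ i` on the hyperboloid, in a form that avoids the disc model. -/
def toUpper (q : Mink) : E3 := !₂[q 1 / (q 0 - q 3), q 2 / (q 0 - q 3), 1 / (q 0 - q 3)]

/-- The inverse of `toUpper`, from the upper half space to the hyperboloid. -/
def ofUpper (y : E3) : Mink :=
  ![(1 + (y 0 ^ 2 + y 1 ^ 2 + y 2 ^ 2)) / (2 * y 2), y 0 / y 2, y 1 / y 2,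
    (y 0 ^ 2 + y 1 ^ 2 + y 2 ^ 2 - 1) / (2 * y 2)]

theorem sub_pos_of_mem_hyperboloid {q : Mink} (hq : q ∈ hyperboloid) : 0 < q 0 - q 3 := by
  obtain ⟨h1, h0⟩ := hq
  simp only [mink] at h1
  nlinarith [sq_nonneg (q 1), sq_nonneg (q 2)]

theorem j_i {q : Mink} (hq : q ∈ hyperboloid) : j (i q) = toUpper q := by
  have hs := (sub_pos_of_mem_hyperboloid hq).ne'
  obtain ⟨h1, h0⟩ := hq
  simp only [mink] at h1
  have hT : 1 + q 0 ≠ 0 := by positivity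
  have e0 : i q 0 = q 1 / (1 + q 0) := rfl
  have e1 : i q 1 = q 2 / (1 + q 0) := rfl
  have e2 : i q 2 = q 3 / (1 + q 0) := rfl
  have hden : i q 0 ^ 2 + i q 1 ^ 2 + (1 - i q 2) ^ 2 = 2 * (q 0 - q 3) / (1 + q 0) := by
    rw [e0, e1, e2]; field_simp; linear_combination -h1
  have hnum : 1 - (i q 0 ^ 2 + i q 1 ^ 2 + i q 2 ^ 2) = 2 / (1 + q 0) := by
    rw [e0, e1, e2]; field_simp; linear_combination h1
  ext m
  simp only [j, hden, hnum, toUpper]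
  fin_cases m <;> simp only [e0, e1, Fin.zero_eta, Fin.mk_one, Fin.reduceFinMk, cons_val] <;>
    field_simp

theorem toUpper_mem_upper {q : Mink} (hq : q ∈ hyperboloid) : toUpper q ∈ upper :=
  one_div_pos.2 (sub_pos_of_mem_hyperboloid hq)

theorem ofUpper_toUpper {q : Mink} (hq : q ∈ hyperboloid) : ofUpper (toUpper q) = q := by
  have hs := (sub_pos_of_mem_hyperboloid hq).ne'
  have h1 := hq.1
  simp only [mink] at h1
  ext m
  fin_cases m <;>
    simp only [ofUpper, toUpper, Fin.zero_eta, Fin.mk_one, Fin.reduceFinMk, cons_val] <;>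
    field_simp
  all_goals linear_combination -h1

theorem injOn_toUpper : Set.InjOn toUpper hyperboloid :=
  Set.LeftInvOn.injOn fun _ hq => ofUpper_toUpper hq

theorem ofUpper_mem_hyperboloid {y : E3} (hy : y ∈ upper) : ofUpper y ∈ hyperboloid := by
  have hy : 0 < y 2 := hy
  constructor
  · simp only [mink, ofUpper, cons_val]
    field_simp
    ring
  · simp only [ofUpper, cons_val]
    positivity

theorem ofUpper_zero_sub_three {y : E3} (hy : y ∈ upper) : ofUpper y 0 - ofUpper y 3 = 1 / y 2 := by
  have hy : 0 < y 2 := hy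
  simp only [ofUpper, cons_val]
  field_simp
  ring

theorem toUpper_ofUpper {y : E3} (hy : y ∈ upper) : toUpper (ofUpper y) = y := by
  have hz : y 2 ≠ 0 := ne_of_gt hy
  ext m
  simp only [toUpper, ofUpper_zero_sub_three hy]
  fin_cases m <;> simp only [ofUpper, Fin.zero_eta, Fin.mk_one, Fin.reduceFinMk, cons_val] <;>
    field_simp

theorem iInv_jInv {y : E3} (hy : y ∈ upper) : iInv (jInv y) = ofUpper y := by
  have hq := ofUpper_mem_hyperboloid hy
  calc iInv (jInv y) = iInv (jInv (j (i (ofUpper y)))) := by rw [j_i hq, toUpper_ofUpper hy]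
    _ = ofUpper y := by rw [(jInv_j (i_mem_disc hq)).2, iInv_i hq]

theorem image_toUpper_h (p : Mink) : toUpper '' h p = {y | y ∈ upper ∧ mink (ofUpper y) p = 1} := by
  ext y
  constructor
  · rintro ⟨q, hq, rfl⟩
    exact ⟨toUpper_mem_upper hq.1, by rw [ofUpper_toUpper hq.1, hq.2]⟩
  · rintro ⟨hy, hyp⟩
    exact ⟨ofUpper y, ⟨ofUpper_mem_hyperboloid hy, hyp⟩, toUpper_ofUpper hy⟩

theorem differentiableAt_i {q : Mink} (hq : 1 + q 0 ≠ 0) : DifferentiableAt ℝ i q := by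
  rw [differentiableAt_euclidean]
  intro m
  fin_cases m <;> simp only [i, Fin.zero_eta, Fin.mk_one, Fin.reduceFinMk, cons_val] <;>
    fun_prop (disch := exact hq)

theorem differentiableAt_toUpper {q : Mink} (hq : q 0 - q 3 ≠ 0) :
    DifferentiableAt ℝ toUpper q := by
  rw [differentiableAt_euclidean]
  intro m
  fin_cases m <;> simp only [toUpper, Fin.zero_eta, Fin.mk_one, Fin.reduceFinMk, cons_val] <;>
    fun_prop (disch := exact hq)

theorem differentiableAt_ofUpper {y : E3} (hy : y 2 ≠ 0) : DifferentiableAt ℝ ofUpper y := by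
  rw [differentiableAt_pi]
  intro m
  fin_cases m <;> simp only [ofUpper, Fin.zero_eta, Fin.mk_one, Fin.reduceFinMk, cons_val] <;>
    fun_prop (disch := first | exact hy | exact mul_ne_zero two_ne_zero hy)

theorem fderiv_toUpper_ofUpper {y : E3} (hy : y ∈ upper) (u : Mink) :
    fderiv ℝ toUpper (ofUpper y) u = !₂[(u 1 - y 0 * (u 0 - u 3)) * y 2,
      (u 2 - y 1 * (u 0 - u 3)) * y 2, -(u 0 - u 3) * y 2 ^ 2] := by
  have hz : y 2 ≠ 0 := ne_of_gt hy
  set q := ofUpper y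
  have hs : q 0 - q 3 = 1 / y 2 := ofUpper_zero_sub_three hy
  have hs0 : q 0 - q 3 ≠ 0 := hs ▸ one_div_ne_zero hz
  have e1 : q 1 = y 0 / y 2 := rfl
  have e2 : q 2 = y 1 / y 2 := rfl
  have hline : HasDerivAt (fun t : ℝ => q + t • u) u 0 := by
    simpa using ((hasDerivAt_id (0 : ℝ)).smul_const u).const_add q
  have hcoord : ∀ m, HasDerivAt (fun t : ℝ => (q + t • u) m) (u m) 0 := hasDerivAt_pi.1 hline
  have hden := (hcoord 0).fun_sub (hcoord 3)
  have hval : ∀ m, HasDerivAt (fun t : ℝ => toUpper (q + t • u) m) (fderiv ℝ toUpper q u m) 0 :=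
    fun m => (EuclideanSpace.proj m : E3 →L[ℝ] ℝ).hasFDerivAt.comp_hasDerivAt 0
      ((differentiableAt_toUpper hs0).hasFDerivAt.comp_hasDerivAt_of_eq 0 hline (by simp))
  have hne : (q + (0 : ℝ) • u) 0 - (q + (0 : ℝ) • u) 3 ≠ 0 := by simpa using hs0
  ext m
  fin_cases m
  · refine ((hval 0).unique ((hcoord 1).fun_div hden hne)).trans ?_
    simp only [zero_smul, add_zero, hs, e1, Fin.zero_eta, cons_val]
    field_simp
  · refine ((hval 1).unique ((hcoord 2).fun_div hden hne)).trans ?_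
    simp only [zero_smul, add_zero, hs, e2, Fin.mk_one, cons_val]
    field_simp
  · refine ((hval 2).unique ((hasDerivAt_const (0 : ℝ) (1 : ℝ)).fun_div hden hne)).trans ?_
    simp [hs]

/-! ### Spinors and their flags -/

section Spinors

variable {κ ν : Fin 2 → ℂ}

/-- The standard symplectic form on `ℂ²`, whose isometry group is `SL(2, ℂ)`. -/
def spinorForm (κ ν : Fin 2 → ℂ) : ℂ := κ 0 * ν 1 - κ 1 * ν 0

theorem spinorForm_mulVec (A : SpecialLinearGroup (Fin 2) ℂ) (κ ν : Fin 2 → ℂ) :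
    spinorForm (A.1 *ᵥ κ) (A.1 *ᵥ ν) = spinorForm κ ν := by
  have hA := A.2
  rw [det_fin_two] at hA
  simp only [spinorForm, mulVec, dotProduct, Fin.sum_univ_two]
  linear_combination (κ 0 * ν 1 - κ 1 * ν 0) * hA

theorem exists_eq_smul_of_spinorForm_eq_zero (hκ : κ ≠ 0) (h0 : spinorForm κ ν = 0) :
    ∃ c : ℂ, ν = c • κ := by
  have h0 : κ 0 * ν 1 = κ 1 * ν 0 := sub_eq_zero.1 h0
  obtain ⟨m, hm⟩ := Function.ne_iff.1 hκ
  have hcomm : ∀ l, ν l * κ m = ν m * κ l := fun l => by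
    fin_cases m <;> fin_cases l <;> simp only [Fin.zero_eta, Fin.mk_one]
    exacts [by linear_combination h0, by linear_combination -h0]
  exact ⟨ν m / κ m, funext fun l => by
    rw [Pi.smul_apply, smul_eq_mul, div_mul_eq_mul_div, eq_div_iff hm, hcomm l]⟩

theorem spinorForm_Z (κ : Fin 2 → ℂ) :
    spinorForm κ (Z κ) =
      (Complex.normSq (κ 0) + Complex.normSq (κ 1) : ℝ) * -Complex.I := by
  simp only [spinorForm, Z, cons_val_zero, cons_val_one, Complex.ofReal_add, Complex.star_def,
    ← Complex.mul_conj]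
  ring

theorem g_f_apply (κ : Fin 2 → ℂ) :
    g (f κ) = ![Complex.normSq (κ 0) + Complex.normSq (κ 1), 2 * (κ 0 * star (κ 1)).re,
      2 * (κ 0 * star (κ 1)).im, Complex.normSq (κ 0) - Complex.normSq (κ 1)] := by
  ext m
  fin_cases m <;> simp [g, f, vecMulVec_apply, Complex.normSq_apply]

theorem g_lineDeriv_f_Z (κ : Fin 2 → ℂ) :
    g (lineDeriv ℝ f κ (Z κ)) = ![0, 2 * (Complex.I * (κ 0 ^ 2 + star (κ 1) ^ 2)).re,
      2 * (Complex.I * (κ 0 ^ 2 + star (κ 1) ^ 2)).im, 4 * (κ 0 * κ 1).im] := by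
  have z0 : Z κ 0 = Complex.I * star (κ 1) := rfl
  have z1 : Z κ 1 = -Complex.I * star (κ 0) := rfl
  ext m
  fin_cases m <;> simp [g, lineDeriv_f, vecMulVec_apply, z0, z1, pow_two] <;> ring

theorem g_f_mem_lightCone (hκ : κ ≠ 0) : g (f κ) ∈ lightCone :=
  g_mem_lightCone (f_mem_hermCone hκ)

theorem normSq_add_normSq_pos (hκ : κ ≠ 0) :
    0 < Complex.normSq (κ 0) + Complex.normSq (κ 1) := by
  simpa [g_f_apply] using (g_f_mem_lightCone hκ).2

theorem mink_g_f (κ ν : Fin 2 → ℂ) :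
    mink (g (f κ)) (g (f ν)) = 2 * Complex.normSq (spinorForm κ ν) := by
  simp only [g_f_apply, mink, spinorForm, cons_val, Complex.normSq_apply, Complex.sub_re,
    Complex.sub_im, Complex.mul_re, Complex.mul_im, Complex.star_def, Complex.conj_re,
    Complex.conj_im]
  ring

theorem lineDeriv_f_smul_add_smul (c : ℂ) (r : ℝ) (κ ν : Fin 2 → ℂ) :
    lineDeriv ℝ f κ (c • κ + r • ν) = (2 * c.re) • f κ + r • lineDeriv ℝ f κ ν := by
  have hc : ((2 * c.re : ℝ) : ℂ) = c + star c := by simp [Complex.add_conj]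
  ext l m
  simp only [lineDeriv_f, f, Submodule.coe_add, Submodule.coe_smul, Matrix.add_apply,
    Matrix.smul_apply, vecMulVec_apply, Pi.star_apply, Pi.add_apply, Pi.smul_apply, smul_eq_mul,
    Complex.real_smul, star_add, star_mul', hc, Complex.star_def, Complex.conj_ofReal]
  ring

theorem lineDeriv_f_mem_pos (hκ : κ ≠ 0) {r : ℝ} (hr : 0 < r)
    (hν : spinorForm κ ν = r * spinorForm κ (Z κ)) : lineDeriv ℝ f κ ν ∈ (F κ hκ).pos := by
  have hsub : spinorForm κ (ν - r • Z κ) = 0 := by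
    simp only [spinorForm, Pi.sub_apply, Pi.smul_apply, Complex.real_smul] at hν ⊢
    linear_combination hν
  obtain ⟨c, hc⟩ := exists_eq_smul_of_spinorForm_eq_zero hκ hsub
  rw [sub_eq_iff_eq_add.1 hc, lineDeriv_f_smul_add_smul]
  exact ⟨2 * c.re, r, hr, rfl⟩

theorem F_neg (hκ : κ ≠ 0) (hκ' : -κ ≠ 0) : F (-κ) hκ' = F κ hκ := by
  have hf : f (-κ) = f κ := by
    ext l m
    simp [f, vecMulVec_apply]
  have hZ : Z (-κ) = -Z κ := by
    ext l
    fin_cases l <;> simp [Z]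
  have hd : lineDeriv ℝ f (-κ) (Z (-κ)) = lineDeriv ℝ f κ (Z κ) := by
    ext l m
    simp [hZ, lineDeriv_f, vecMulVec_apply]
  simp only [F, Flag.mk', hf, hd]

end Spinors

/-! ### The action of `SL(2, ℂ)` -/

section Action

variable (A : SpecialLinearGroup (Fin 2) ℂ)

theorem minkAct_add (p q : Mink) : minkAct A (p + q) = minkAct A p + minkAct A q := by
  rw [minkAct, minkAct, minkAct, ← map_add, map_add g.symm]
  congr 1
  apply Subtype.ext
  simp [hermAct, Matrix.mul_add, Matrix.add_mul]

theorem minkAct_smul (c : ℝ) (p : Mink) : minkAct A (c • p) = c • minkAct A p := by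
  rw [minkAct, minkAct, ← map_smul, map_smul g.symm]
  congr 1
  apply Subtype.ext
  simp [hermAct]

theorem minkAct_one (p : Mink) : minkAct 1 p = p := by
  have : hermAct 1 (g.symm p) = g.symm p := by
    apply Subtype.ext
    simp [hermAct]
  rw [minkAct, this, g.apply_symm_apply]

theorem minkAct_mul (B : SpecialLinearGroup (Fin 2) ℂ) (p : Mink) :
    minkAct (A * B) p = minkAct A (minkAct B p) := by
  rw [minkAct, minkAct, minkAct, g.symm_apply_apply]
  congr 1
  apply Subtype.ext
  simp [hermAct, Matrix.mul_assoc]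

/-- The action of `A ∈ SL(2, ℂ)` on Minkowski space as a continuous linear automorphism. -/
def minkActEquiv : Mink ≃L[ℝ] Mink :=
  LinearEquiv.toContinuousLinearEquiv
    { toFun := minkAct A
      map_add' := minkAct_add A
      map_smul' := minkAct_smul A
      invFun := minkAct A⁻¹
      left_inv := fun p => by rw [← minkAct_mul, inv_mul_cancel, minkAct_one]
      right_inv := fun p => by rw [← minkAct_mul, mul_inv_cancel, minkAct_one] }

theorem minkAct_g_f (κ : Fin 2 → ℂ) : minkAct A (g (f κ)) = g (f (A.1 *ᵥ κ)) := by
  rw [minkAct, g.symm_apply_apply]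
  congr 1
  apply Subtype.ext
  simp only [hermAct, f]
  rw [mul_vecMulVec, vecMulVec_mul, star_mulVec]

theorem minkAct_g_lineDeriv_f (κ ν : Fin 2 → ℂ) :
    minkAct A (g (lineDeriv ℝ f κ ν)) = g (lineDeriv ℝ f (A.1 *ᵥ κ) (A.1 *ᵥ ν)) := by
  rw [minkAct, g.symm_apply_apply]
  congr 1
  apply Subtype.ext
  simp only [hermAct, lineDeriv_f]
  rw [Matrix.mul_add, Matrix.add_mul, mul_vecMulVec, mul_vecMulVec, vecMulVec_mul, vecMulVec_mul,
    star_mulVec, star_mulVec]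

theorem mink_g_self (S : Herm) : ((mink (g S) (g S) : ℝ) : ℂ) = 4 * S.1.det := by
  have hS : ∀ m l, star (S.1 l m) = S.1 m l := fun m l => congrFun (congrFun S.2 m) l
  have e0 : (S.1 0 0).im = 0 := Complex.conj_eq_iff_im.1 (hS 0 0)
  have e1 : (S.1 1 1).im = 0 := Complex.conj_eq_iff_im.1 (hS 1 1)
  rw [det_fin_two, ← hS 1 0]
  apply Complex.ext
  · simp [mink, g, e0, e1]; ring
  · simp [e0, e1]; ring

theorem mink_minkAct_self (p : Mink) : mink (minkAct A p) (minkAct A p) = mink p p := by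
  have hdet : (hermAct A (g.symm p)).1.det = (g.symm p).1.det := by
    simp [hermAct, det_mul, det_conjTranspose, A.2]
  have hp := mink_g_self (hermAct A (g.symm p))
  rw [hdet, ← mink_g_self, g.apply_symm_apply] at hp
  exact_mod_cast hp

theorem mink_minkAct (p q : Mink) : mink (minkAct A p) (minkAct A q) = mink p q := by
  have polarization (x y : Mink) :
      mink x y = (mink (x + y) (x + y) - mink x x - mink y y) / 2 := by
    simp only [mink_add_left, mink_add_right, mink_comm y x]; ring
  rw [polarization, ← minkAct_add, mink_minkAct_self, mink_minkAct_self, mink_minkAct_self,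
    ← polarization]

theorem mulVec_ne_zero {κ : Fin 2 → ℂ} (hκ : κ ≠ 0) : A.1 *ᵥ κ ≠ 0 := fun h0 => by
  have hdet := exists_mulVec_eq_zero_iff.1 ⟨κ, hκ, h0⟩
  simp [A.2] at hdet

theorem minkAct_mem_hyperboloid {q : Mink} (hq : q ∈ hyperboloid) : minkAct A q ∈ hyperboloid := by
  have hκ : (![1, 0] : Fin 2 → ℂ) ≠ 0 := by simp
  have hm : mink (minkAct A q) (minkAct A q) = 1 := (mink_minkAct_self A q).trans hq.1
  refine ⟨hm, (mink_pos_iff hm (g_f_mem_lightCone (mulVec_ne_zero A hκ))).1 ?_⟩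
  rw [← minkAct_g_f, mink_minkAct, mink_pos_iff hq.1 (g_f_mem_lightCone hκ)]
  exact hq.2

theorem upperAct_eq {y : E3} (hy : y ∈ upper) :
    upperAct A y = toUpper (minkAct A (ofUpper y)) := by
  rw [upperAct, discAct, iInv_jInv hy,
    j_i (minkAct_mem_hyperboloid A (ofUpper_mem_hyperboloid hy))]

theorem differentiableAt_upperAct {y : E3} (hy : y ∈ upper) :
    DifferentiableAt ℝ (upperAct A) y := by
  have hopen : IsOpen upper := isOpen_lt continuous_const (by fun_prop)
  have hs := sub_pos_of_mem_hyperboloid (minkAct_mem_hyperboloid A (ofUpper_mem_hyperboloid hy))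
  have hcomp : DifferentiableAt ℝ (toUpper ∘ minkActEquiv A ∘ ofUpper) y :=
    DifferentiableAt.comp y (differentiableAt_toUpper hs.ne')
      ((minkActEquiv A).differentiableAt.comp y (differentiableAt_ofUpper (ne_of_gt hy)))
  refine hcomp.congr_of_eventuallyEq ?_
  filter_upwards [hopen.mem_nhds hy] with x hx using upperAct_eq A hx

end Action

/-! ### Equivariance -/

theorem K_eq_push_toUpper {κ : Fin 2 → ℂ} (hκ : κ ≠ 0) :
    K κ hκ = (H (G (F κ hκ))).push toUpper := by
  have hi : ∀ q ∈ h (g (f κ)), DifferentiableAt ℝ i q := fun q hq =>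
    differentiableAt_i (by have := hq.1.2; positivity)
  have hj : ∀ q ∈ h (g (f κ)), DifferentiableAt ℝ j (i q) := fun q hq =>
    differentiableAt_j (disc_pos (i_mem_disc hq.1)).1.ne'
  rw [K, DirectedSet.push_push hi hj]
  exact (isOrientedLineField_H _).push_congr (fun q hq => j_i hq.1)
    (fun q hq => (hj q hq).comp q (hi q hq))
    fun q hq => differentiableAt_toUpper (sub_pos_of_mem_hyperboloid hq.1).ne'

theorem carrier_K {κ : Fin 2 → ℂ} (hκ : κ ≠ 0) : (K κ hκ).carrier = toUpper '' h (g (f κ)) := by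
  rw [K_eq_push_toUpper hκ]; rfl

theorem isOrientedLineField_K {κ : Fin 2 → ℂ} (hκ : κ ≠ 0) : (K κ hκ).IsOrientedLineField := by
  rw [K_eq_push_toUpper hκ]
  exact (isOrientedLineField_H _).push (ψ := ofUpper)
    (fun q hq => differentiableAt_toUpper (sub_pos_of_mem_hyperboloid hq.1).ne')
    (fun q hq => differentiableAt_ofUpper (ne_of_gt (toUpper_mem_upper hq.1)))
    fun q hq => ofUpper_toUpper hq.1

theorem push_minkAct_H_F (A : SpecialLinearGroup (Fin 2) ℂ) {κ : Fin 2 → ℂ} (hκ : κ ≠ 0) :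
    (H (G (F κ hκ))).push (minkActEquiv A) = H (G (F (A.1 *ᵥ κ) (mulVec_ne_zero A hκ))) := by
  have hAκ := mulVec_ne_zero A hκ
  have hn := normSq_add_normSq_pos hκ
  have hnA := normSq_add_normSq_pos hAκ
  refine push_H (v := g (lineDeriv ℝ f κ (Z κ))) (mink_minkAct A) (minkAct_g_f A κ)
    (Set.mem_image_of_mem g (lineDeriv_f_mem_pos hκ one_pos (by simp))) ?_
  refine ⟨_, lineDeriv_f_mem_pos hAκ (div_pos hn hnA) ?_, (minkAct_g_lineDeriv_f A κ _).symm⟩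
  rw [spinorForm_mulVec, spinorForm_Z, spinorForm_Z, ← mul_assoc, ← Complex.ofReal_mul,
    div_mul_cancel₀ _ hnA.ne']

theorem push_upperAct_K (A : SpecialLinearGroup (Fin 2) ℂ) {κ : Fin 2 → ℂ} (hκ : κ ≠ 0) :
    (K κ hκ).push (upperAct A) = K (A.1 *ᵥ κ) (mulVec_ne_zero A hκ) := by
  have hU : ∀ q ∈ hyperboloid, DifferentiableAt ℝ toUpper q := fun q hq =>
    differentiableAt_toUpper (sub_pos_of_mem_hyperboloid hq).ne'
  have hA : ∀ q ∈ hyperboloid, DifferentiableAt ℝ (upperAct A) (toUpper q) := fun q hq =>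
    differentiableAt_upperAct A (toUpper_mem_upper hq)
  have hL : ∀ q, DifferentiableAt ℝ (minkActEquiv A) q := fun _ => (minkActEquiv A).differentiableAt
  have hUL : ∀ q ∈ hyperboloid, DifferentiableAt ℝ toUpper (minkActEquiv A q) := fun q hq =>
    hU _ (minkAct_mem_hyperboloid A hq)
  rw [K_eq_push_toUpper hκ, K_eq_push_toUpper, ← push_minkAct_H_F A hκ,
    DirectedSet.push_push (X := H (G (F κ hκ))) (fun q hq => hU q hq.1) (fun q hq => hA q hq.1),
    DirectedSet.push_push (X := H (G (F κ hκ))) (fun q _ => hL q) (fun q hq => hUL q hq.1)]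
  refine (isOrientedLineField_H _).push_congr (fun q hq => ?_)
    (fun q hq => (hA q hq.1).comp q (hU q hq.1)) fun q hq => (hUL q hq.1).comp q (hL q)
  change upperAct A (toUpper q) = toUpper (minkAct A q)
  rw [upperAct_eq A (toUpper_mem_upper hq.1), ofUpper_toUpper hq.1]

/-! ### Parallelism -/

theorem sq_sub_trace_mul_add_det_eq_zero {M : Matrix (Fin 2) (Fin 2) ℂ} {κ : Fin 2 → ℂ}
    (hκ : κ ≠ 0) {ε : ℂ} (hε : M *ᵥ κ = ε • κ) : ε ^ 2 - M.trace * ε + M.det = 0 := by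
  have hdet : (M - ε • 1).det = 0 := exists_mulVec_eq_zero_iff.1
    ⟨κ, hκ, by rw [sub_mulVec, hε, smul_mulVec, one_mulVec, sub_self]⟩
  simp only [det_fin_two, Matrix.sub_apply, Matrix.smul_apply, one_apply_eq, smul_eq_mul, mul_one,
    one_apply_ne zero_ne_one, one_apply_ne one_ne_zero, mul_zero, sub_zero] at hdet
  rw [trace_fin_two, det_fin_two]
  linear_combination hdet

theorem IsParabolic.eq_one_or_neg_one {A : SpecialLinearGroup (Fin 2) ℂ} (hA : IsParabolic A)
    {κ : Fin 2 → ℂ} (hκ : κ ≠ 0) {ε : ℂ} (hε : A.1 *ᵥ κ = ε • κ) : ε = 1 ∨ ε = -1 := by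
  have hchar := sq_sub_trace_mul_add_det_eq_zero hκ hε
  rw [A.2] at hchar
  rcases hA with htr | htr <;> rw [htr] at hchar
  · have : (ε - 1) ^ 2 = 0 := by linear_combination hchar
    exact Or.inl (sub_eq_zero.1 (pow_eq_zero_iff two_ne_zero |>.1 this))
  · have : (ε + 1) ^ 2 = 0 := by linear_combination hchar
    exact Or.inr (eq_neg_of_add_eq_zero_left (pow_eq_zero_iff two_ne_zero |>.1 this))

theorem spinorForm_eq_zero_of_h_subset {κ ν : Fin 2 → ℂ} (hκ : κ ≠ 0)
    (hsub : h (g (f κ)) ⊆ h (g (f ν))) : spinorForm κ ν = 0 := by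
  have hp := g_f_mem_lightCone hκ
  obtain ⟨q, hq⟩ := h_nonempty hp
  obtain ⟨u, hu, hu0, -⟩ := (isOrientedLineField_H (G (F κ hκ))).1 q hq
  have h0 := mink_eq_zero_of_h_subset hp hq hu hu0 hsub
  rw [mink_g_f] at h0
  exact Complex.normSq_eq_zero.1 ((mul_eq_zero.1 h0).resolve_left two_ne_zero)

theorem isParallel_K {κ : Fin 2 → ℂ} (hκ : κ ≠ 0) : IsParallel (K κ hκ) := by
  intro A hA himage
  have hκA := mulVec_ne_zero A hκ
  have hK := push_upperAct_K A hκ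
  have hcarrier : toUpper '' h (g (f κ)) = toUpper '' h (g (f (A.1 *ᵥ κ))) := by
    rw [← carrier_K hκ, ← carrier_K hκA, ← hK]
    exact himage.symm
  have hh := (injOn_toUpper.image_eq_image_iff (fun q hq => hq.1) fun q hq => hq.1).1 hcarrier
  obtain ⟨ε, hε⟩ :=
    exists_eq_smul_of_spinorForm_eq_zero hκ (spinorForm_eq_zero_of_h_subset hκ hh.subset)
  rw [hK]
  rcases hA.eq_one_or_neg_one hκ hε with rfl | rfl
  · simp only [hε, one_smul]
  · simp only [hε, neg_one_smul, K, F_neg hκ]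

theorem isHorosphere_K {κ : Fin 2 → ℂ} (hκ : κ ≠ 0) : IsHorosphere (K κ hκ).carrier :=
  ⟨_, isHorosphereHyp_h (g_f_mem_lightCone hκ), rfl⟩

theorem isDecoratedHorosphere_K {κ : Fin 2 → ℂ} (hκ : κ ≠ 0) :
    IsDecoratedHorosphere (K κ hκ) :=
  ⟨isHorosphere_K hκ, isOrientedLineField_K hκ, isParallel_K hκ⟩

/-! ### Explicit description in the upper half space -/

section Explicit

variable {κ : Fin 2 → ℂ}

theorem mem_carrier_K_iff (hκ : κ ≠ 0) {y : E3} : y ∈ (K κ hκ).carrier ↔ y ∈ upper ∧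
    Complex.normSq (κ 0 - κ 1 * ⟨y 0, y 1⟩) + Complex.normSq (κ 1) * y 2 ^ 2 = y 2 := by
  rw [carrier_K, image_toUpper_h]
  refine and_congr_right fun hy => ?_
  have hz : y 2 ≠ 0 := ne_of_gt hy
  have hmink : mink (ofUpper y) (g (f κ)) =
      (Complex.normSq (κ 0 - κ 1 * ⟨y 0, y 1⟩) + Complex.normSq (κ 1) * y 2 ^ 2) / y 2 := by
    rw [g_f_apply]
    simp only [mink, ofUpper, cons_val, Complex.normSq_apply, Complex.sub_re, Complex.sub_im,
      Complex.mul_re, Complex.mul_im, Complex.star_def, Complex.conj_re, Complex.conj_im]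
    field_simp
    ring
  rw [hmink, div_eq_one_iff_eq hz]

/-- The vector at the point `y` of the horosphere of `κ` which directs the decoration. It has
horizontal part `i (a² + (κ̄₁ z)²)` and vertical part `2 z Im (a κ₁)`, where `z` is the height of
`y` and `a = κ₀ - κ₁ ζ` vanishes when `y` lies above the centre. -/
def spinorDirection (κ : Fin 2 → ℂ) (y : E3) : E3 :=
  horizontal (Complex.I * ((κ 0 - κ 1 * ⟨y 0, y 1⟩) ^ 2 + (star (κ 1) * y 2) ^ 2)) +
    EuclideanSpace.single 2 (2 * y 2 * ((κ 0 - κ 1 * ⟨y 0, y 1⟩) * κ 1).im)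

theorem fderiv_toUpper_horoVec (hκ : κ ≠ 0) {y : E3} (hy : y ∈ (K κ hκ).carrier) :
    fderiv ℝ toUpper (ofUpper y) (horoVec (g (f κ)) (g (lineDeriv ℝ f κ (Z κ))) (ofUpper y)) =
      (2 * (Complex.normSq (κ 0) + Complex.normSq (κ 1))) • spinorDirection κ y := by
  obtain ⟨hyU, hy⟩ := (mem_carrier_K_iff hκ).1 hy
  have hz : y 2 ≠ 0 := ne_of_gt hyU
  simp only [Complex.normSq_apply, Complex.sub_re, Complex.sub_im, Complex.mul_re,
    Complex.mul_im] at hy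
  rw [fderiv_toUpper_ofUpper hyU, horoVec, g_f_apply, g_lineDeriv_f_Z]
  ext m
  fin_cases m <;>
    simp [spinorDirection, horizontal, mink, ofUpper, Complex.normSq_apply, pow_two] <;>
    field_simp
  -- The coefficients are, up to powers of `y 2`, `-2` times the coordinates of the image of
  -- `g (lineDeriv ℝ f κ (Z κ))` under the derivative of `toUpper`.
  · linear_combination (8 * ((κ 0).re * (κ 0).im - (κ 1).re * (κ 1).im -
      y 0 * ((κ 0).re * (κ 1).im + (κ 0).im * (κ 1).re))) * hy
  · linear_combination (-4 * ((κ 0).re ^ 2 - (κ 0).im ^ 2 + (κ 1).re ^ 2 - (κ 1).im ^ 2 +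
      2 * y 1 * ((κ 0).re * (κ 1).im + (κ 0).im * (κ 1).re))) * hy
  · linear_combination (-8 * ((κ 0).re * (κ 1).im + (κ 0).im * (κ 1).re)) * hy

theorem dir_K (hκ : κ ≠ 0) {y : E3} (hy : y ∈ (K κ hκ).carrier) :
    (K κ hκ).dir y = openRay (spinorDirection κ y) := by
  have hvec := fderiv_toUpper_horoVec hκ hy
  have hv : g (lineDeriv ℝ f κ (Z κ)) ∈ (G (F κ hκ)).pos :=
    Set.mem_image_of_mem g (lineDeriv_f_mem_pos hκ one_pos (by simp))
  have hscale := mul_pos two_pos (normSq_add_normSq_pos hκ)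
  rw [carrier_K] at hy
  obtain ⟨q, hq, rfl⟩ := hy
  rw [ofUpper_toUpper hq.1] at hvec
  have hinj : (h (g (f κ))).InjOn toUpper := injOn_toUpper.mono fun _ hx => hx.1
  rw [K_eq_push_toUpper hκ, DirectedSet.dir_push_of_injOn hinj hq,
    dir_H _ hv hq, image_openRay, ← openRay_smul hscale (spinorDirection _ _), ← hvec]
  rfl

theorem carrier_K_of_apply_one_eq_zero (hκ : κ ≠ 0) (h1 : κ 1 = 0) :
    (K κ hκ).carrier = {x | x 2 = ‖κ 0‖ ^ 2} := by
  have hpos : 0 < ‖κ 0‖ ^ 2 := by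
    simpa only [h1, map_zero, add_zero, Complex.normSq_eq_norm_sq] using normSq_add_normSq_pos hκ
  ext y
  rw [mem_carrier_K_iff]
  simp only [h1, zero_mul, sub_zero, map_zero, add_zero, Complex.normSq_eq_norm_sq,
    Set.mem_ofPred_eq]
  exact ⟨fun hy => hy.2.symm, fun hy => ⟨hpos.trans_eq hy.symm, hy.symm⟩⟩

theorem isSpecification_K (hκ : κ ≠ 0) (h1 : κ 1 = 0) :
    IsSpecification (K κ hκ) (Complex.I * κ 0 ^ 2) := by
  intro y hy
  rw [dir_K hκ hy]
  convert self_mem_openRay _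
  simp [spinorDirection, h1]

theorem norm_zpow_neg_two (η : ℂ) : ‖η‖ ^ (-2 : ℤ) = (Complex.normSq η)⁻¹ := by
  rw [Complex.normSq_eq_norm_sq]; exact _root_.zpow_neg _ 2

theorem carrier_K_of_apply_one_ne_zero (hκ : κ ≠ 0) (h1 : κ 1 ≠ 0) :
    (K κ hκ).carrier = Metric.sphere !₂[(κ 0 / κ 1).re, (κ 0 / κ 1).im, ‖κ 1‖ ^ (-2 : ℤ) / 2]
      (‖κ 1‖ ^ (-2 : ℤ) / 2) ∩ upper := by
  ext y
  rw [mem_carrier_K_iff, Set.inter_comm, Set.mem_inter_iff]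
  refine and_congr_right fun _ => ?_
  have hN := Complex.normSq_pos.2 h1
  have ha : Complex.normSq (κ 0 - κ 1 * ⟨y 0, y 1⟩) =
      Complex.normSq (κ 1) * ((y 0 - (κ 0 / κ 1).re) ^ 2 + (y 1 - (κ 0 / κ 1).im) ^ 2) := by
    have : κ 0 - κ 1 * ⟨y 0, y 1⟩ = κ 1 * (κ 0 / κ 1 - ⟨y 0, y 1⟩) := by field_simp
    rw [this, map_mul, Complex.normSq_apply (_ - _), Complex.sub_re, Complex.sub_im]
    ring
  rw [ha, norm_zpow_neg_two, Metric.mem_sphere, dist_eq_norm,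
    ← sq_eq_sq₀ (norm_nonneg _) (by positivity), norm_sq_E3]
  simp only [PiLp.sub_apply, cons_val_zero, cons_val_one, cons_val]
  constructor <;> intro hy <;> field_simp at hy ⊢
  · linear_combination 4 * Complex.normSq (κ 1) * hy
  · refine mul_left_cancel₀ hN.ne' ?_
    linear_combination hy / 4

theorem isNorthPole_sphere_inter_upper {c : E3} {r : ℝ} (hr : 0 ≤ r) (hc : 0 < c 2 + r) :
    IsNorthPole (Metric.sphere c r ∩ upper) (c + EuclideanSpace.single 2 r) := by
  refine ⟨⟨by simp [abs_of_nonneg hr], by simpa [upper] using hc⟩, fun q hq hne => ?_⟩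
  have hsphere : (q 0 - c 0) ^ 2 + (q 1 - c 1) ^ 2 + (q 2 - c 2) ^ 2 = r ^ 2 := by
    rw [← mem_sphere_iff_norm.1 hq.1, norm_sq_E3]; rfl
  by_contra! hle
  have hle : c 2 + r ≤ q 2 := by simpa using hle
  have h0 : q 0 = c 0 := by nlinarith [sq_nonneg (q 1 - c 1), sq_nonneg (q 0 - c 0)]
  have h1 : q 1 = c 1 := by nlinarith [sq_nonneg (q 1 - c 1), sq_nonneg (q 0 - c 0)]
  have h2 : q 2 = c 2 + r := by nlinarith [sq_nonneg (q 1 - c 1), sq_nonneg (q 0 - c 0)]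
  refine hne ?_
  ext m
  fin_cases m <;> simp [h0, h1, h2]

theorem isNorthPoleSpecification_K (hκ : κ ≠ 0) (h1 : κ 1 ≠ 0) :
    IsNorthPoleSpecification (K κ hκ) (Complex.I * κ 1 ^ (-2 : ℤ)) := by
  set c : E3 := !₂[(κ 0 / κ 1).re, (κ 0 / κ 1).im, ‖κ 1‖ ^ (-2 : ℤ) / 2] with hc
  set n : E3 := c + EuclideanSpace.single 2 (‖κ 1‖ ^ (-2 : ℤ) / 2) with hn
  have hpole : IsNorthPole (K κ hκ).carrier n := by
    rw [carrier_K_of_apply_one_ne_zero hκ h1]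
    have : 0 < ‖κ 1‖ := norm_pos_iff.2 h1
    refine isNorthPole_sphere_inter_upper (by positivity) ?_
    simp only [cons_val]
    positivity
  have hζ : (⟨n 0, n 1⟩ : ℂ) = κ 0 / κ 1 := by simp [hn, hc]
  have hz : star (κ 1) * n 2 = (κ 1)⁻¹ := by
    have : n 2 = (Complex.normSq (κ 1))⁻¹ := by simp [hn, hc, ← norm_zpow_neg_two]
    rw [this, Complex.inv_def]; rfl
  have hdir : spinorDirection κ n = horizontal (Complex.I * κ 1 ^ (-2 : ℤ)) := by
    rw [spinorDirection, hζ, hz, mul_div_cancel₀ _ h1, sub_self]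
    simp [_root_.zpow_neg]
  refine ⟨n, hpole, ?_⟩
  rw [dir_K hκ hpole.1, hdir]
  exact self_mem_openRay _

theorem jBdry_iBdry {p : Mink} (hp : p ∈ lightCone) : jBdry (iBdry p) =
    if p 0 = p 3 then OnePoint.infty else ((p 1 + Complex.I * p 2) / (p 0 - p 3) : ℂ) := by
  have hp0 := hp.2.ne'
  have hpole : iBdry p = !₂[0, 0, 1] ↔ p 0 = p 3 := by
    constructor
    · intro hb
      have : p 3 / p 0 = 1 := congrArg (fun x : E3 => x 2) hb
      exact (div_eq_one_iff_eq hp0).1 this |>.symm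
    · intro h3
      have hsum := hp.1
      simp only [mink, h3] at hsum
      have h1 : p 1 = 0 := by nlinarith [sq_nonneg (p 1), sq_nonneg (p 2)]
      have h2 : p 2 = 0 := by nlinarith [sq_nonneg (p 1), sq_nonneg (p 2)]
      have h0 : p 3 / p 0 = 1 := by rw [h3, div_self (h3 ▸ hp0)]
      simp [iBdry, h0, h1, h2]
  rw [jBdry]
  simp only [hpole]
  split_ifs with h3
  · rfl
  · have hp0' : (p 0 : ℂ) ≠ 0 := by exact_mod_cast hp0
    have h3' : (p 0 : ℂ) - p 3 ≠ 0 := by exact_mod_cast sub_ne_zero.2 h3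
    simp only [iBdry, cons_val_zero, cons_val_one, cons_val]
    push_cast
    congr 1
    field_simp

theorem isCentre_K (hκ : κ ≠ 0) : IsCentre (K κ hκ).carrier
    (if κ 1 = 0 then OnePoint.infty else ((κ 0 / κ 1 : ℂ) : OnePoint ℂ)) := by
  have hp := g_f_mem_lightCone hκ
  have hvert : κ 1 = 0 ↔ g (f κ) 0 = g (f κ) 3 := by
    simp only [g_f_apply, cons_val_zero, cons_val]
    rw [← Complex.normSq_eq_zero]
    constructor <;> intro <;> linarith
  refine ⟨_, _, isCentreHyp_h hp, rfl, ?_⟩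
  rw [jBdry_iBdry hp, if_congr hvert rfl rfl]
  split_ifs with h0
  · rfl
  have h1 : κ 1 ≠ 0 := mt hvert.1 h0
  have hnum : (g (f κ) 1 + Complex.I * g (f κ) 2 : ℂ) = 2 * (κ 0 * star (κ 1)) := by
    rw [← Complex.re_add_im (κ 0 * star (κ 1))]
    simp only [g_f_apply, cons_val_one, cons_val]
    push_cast
    ring
  have hden : (g (f κ) 0 - g (f κ) 3 : ℂ) = 2 * (κ 1 * star (κ 1)) := by
    rw [Complex.star_def, Complex.mul_conj]
    simp only [g_f_apply, cons_val_zero, cons_val]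
    push_cast
    ring
  rw [hnum, hden, mul_div_mul_left _ _ two_ne_zero, mul_div_mul_right _ _ (star_ne_zero.2 h1)]

end Explicit

end SpinorHorosphere

end

open SpinorHorosphere in
theorem theorem1p2 (ξ η : ℂ) (hκ : ![ξ, η] ≠ 0) :
    IsDecoratedHorosphere (K ![ξ, η] hκ) ∧
    IsCentre (K ![ξ, η] hκ).carrier
      (if η = 0 then OnePoint.infty else ((ξ / η : ℂ) : OnePoint ℂ)) ∧
    (η ≠ 0 →
      (K ![ξ, η] hκ).carrier =
        Metric.sphere !₂[(ξ / η).re, (ξ / η).im, ‖η‖ ^ (-2 : ℤ) / 2] (‖η‖ ^ (-2 : ℤ) / 2) ∩ upper ∧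
      IsNorthPoleSpecification (K ![ξ, η] hκ) (Complex.I * η ^ (-2 : ℤ))) ∧
    (η = 0 →
      (K ![ξ, η] hκ).carrier = {x | x 2 = ‖ξ‖ ^ 2} ∧
      IsSpecification (K ![ξ, η] hκ) (Complex.I * ξ ^ 2)) ∧
    (K ![ξ, η] hκ).carrier = k ![ξ, η] := by
  exact ⟨isDecoratedHorosphere_K hκ, isCentre_K hκ,
    fun hη => ⟨carrier_K_of_apply_one_ne_zero hκ hη, isNorthPoleSpecification_K hκ hη⟩,
    fun hη => ⟨carrier_K_of_apply_one_eq_zero hκ hη, isSpecification_K hκ hη⟩, rfl⟩
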